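/- Let $0<p<\pi/2$ and $\psi_k(x)=T_k\!\left(\frac{\sin(px)}{\sin p}\right)$, where $T_k$ is the $k$-th Chebyshev polynomial, and $S_n=\operatorname{span}_{\mathbb C}\{\psi_0,\dots,\psi_n\}$. Put $g(y;p)=\frac1p\arcsin(y\sin p)$. For $f$ on $[-1,1]$ (complex-valued) put $\tilde f(y)=f(g(y;p))$, $y\in[-1,1]$. Let $f_n=\sum_{k=0}^n a_k\psi_k$, $a_k=\langle f,\psi_k\rangle/\langle\psi_k,\psi_k\rangle$, be the projection of $f$ on $S_n$ with respect to $\langle u,v\rangle=\int_{-1}^1 u\,v\,\bar w\,dx$, $\bar w(x)=\cos(px)/\sqrt{1-\sin^2(px)/\sin^2p}$, and let $u_n$ be the interpolant of $f$ in $S_n$ at the points $x_i=g(y_i;p)$, $y_i=\cos(i\pi/n)$, $0\le i\le n$ (for $n=0$: at the single point $x_0=1$). For $z\in\mathbb C$ let $|\theta(z)|$ be the larger of the two values $|z\pm\sqrt{z^2-1}|$. For $t>1$ let $B_t=\{z:|\theta(z)|=t\}$, an ellipse with foci $\pm1$ whose inside is $\{z:|\theta(z)|<t\}$. Assume that the nearest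 singularities of $\tilde f$ are at $y=\pm1/\sin p$, that is: $\tilde f$ extends to a function $F$ that is analytic inside the curve $B_t$ that passes through $\pm1/\sin p$, and for at least one of the points $s=\pm 1/\sin p$ there is no function analytic near $s$ that agrees with $F$ near $s$ inside that curve. (In particular $f$ is analytic on $[-1,1]$.) Then: 1. The largest $t>1$ such that $\tilde f$ extends analytically to the inside of $B_t$ is $$t=\frac1{\sin p}+\sqrt{\frac1{\sin^2p}-1}=\frac{1+\cos p}{\sin p}=\cot\frac p2,\qquad \frac1t=\tan\frac p2 .$$ 2. Approximating $f$ in $S_n$ is equivalent to approximating $\tilde f$ by polynomials of degree at most $n$. For every $n$, on $[-1,1]$, $f_n(x)$ is the value at $y=\sin(px)/\sin p$ of the truncated Chebyshev expansion $\sum_{k=0}^n\tilde a_kT_k(y)$ of $\tilde f$, where $\tilde a_k=\frac{2}{\beta_k\pi}\int_{-1}^1\frac{\tilde f(y)T_k(y)}{\sqrt{1-y^2}}dy$, $\beta_0=2$, $\beta_k=1$ for $k\ge1$. The interpolant $u_n$ exists, is unique, and is the value at $y=\sin(px)/\sin p$ of the polynomial of degree at most $n$ that interpolates $\tilde f$ at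 $y_0,\dots,y_n$. The uniform errors on $[-1,1]$ of the projections agree, those of the interpolants agree, and $\inf_{v\in S_n}\|f-v\|_\infty$ equals the error of best uniform approximation of $\tilde f$ by polynomials of degree at most $n$. 3. The asymptotic rate of convergence is $\tan(p/2)$: with the uniform norm on $[-1,1]$, $$\limsup_{n\to\infty}\|f-f_n\|_\infty^{1/n}=\limsup_{n\to\infty}\|f-u_n\|_\infty^{1/n}=\limsup_{n\to\infty}\Big(\inf_{v\in S_n}\|f-v\|_\infty\Big)^{1/n}=\tan\frac p2 .$$ 4. For every $r>\tan(p/2)$, and also for $r=\tan(p/2)$ if $F$ is bounded inside $B_{\cot(p/2)}$, there is a constant $c$, independent of $n$, such that $\|f-f_n\|_\infty$, $\|f-u_n\|_\infty$ and $\inf_{v\in S_n}\|f-v\|_\infty$ are at most $c\,r^n$ for all $n\ge0$. -/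

import Mathlib

open Filter Topology Set
open scoped ENNReal NNReal

noncomputable section

namespace Nptp

/-- The basis functions `ψ_k(x) = T_k (sin (p x) / sin p)`, with `T_k` the Chebyshev polynomials. -/
def psi (p : ℝ) (k : ℕ) (x : ℝ) : ℂ :=
  (((Polynomial.Chebyshev.T ℝ (k : ℤ)).eval (Real.sin (p * x) / Real.sin p) : ℝ) : ℂ)

/-- `S_n = span {ψ_0, …, ψ_n}`. -/
def S (p : ℝ) (n : ℕ) : Submodule ℂ (ℝ → ℂ) :=
  Submodule.span ℂ {u | ∃ k ≤ n, u = psi p k}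

/-- `g(y; p) = (1 / p) arcsin (y sin p)`, the inverse on `[-1, 1]` of `x ↦ sin (p x) / sin p`. -/
def g (p y : ℝ) : ℝ := 1 / p * Real.arcsin (y * Real.sin p)

/-- The transplanted function `f̃(y) = f (g (y; p))`. -/
def ftilde (p : ℝ) (f : ℝ → ℂ) (y : ℝ) : ℂ := f (g p y)

/-- The weight `cos (p x) / √(1 - sin² (p x) / sin² p)` on `[-1, 1]`. -/
def weight (p x : ℝ) : ℝ :=
  Real.cos (p * x) / √(1 - Real.sin (p * x) ^ 2 / Real.sin p ^ 2)

/-- The weighted product `<u, v>`; its second argument is always real-valued below. -/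
def innerW (p : ℝ) (u v : ℝ → ℂ) : ℂ :=
  ∫ x in (-1 : ℝ)..1, u x * v x * (weight p x : ℂ)

/-- The orthogonal projection of `f` on `S_n`. -/
def proj (p : ℝ) (f : ℝ → ℂ) (n : ℕ) (x : ℝ) : ℂ :=
  ∑ k ∈ Finset.range (n + 1),
    innerW p f (psi p k) / innerW p (psi p k) (psi p k) * psi p k x

/-- The Chebyshev coefficient `2 / (β_k π) ∫ h T_k / √(1 - y²)`, where `β_0 = 2`, `β_k = 1`. -/
def chebCoeff (h : ℝ → ℂ) (k : ℕ) : ℂ :=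
  2 / ((if k = 0 then 2 else 1) * (Real.pi : ℂ)) *
    ∫ y in (-1 : ℝ)..1,
      h y * (((Polynomial.Chebyshev.T ℝ (k : ℤ)).eval y / √(1 - y ^ 2) : ℝ) : ℂ)

/-- The truncated Chebyshev expansion of `h`. -/
def chebProj (h : ℝ → ℂ) (n : ℕ) (y : ℝ) : ℂ :=
  ∑ k ∈ Finset.range (n + 1),
    chebCoeff h k * (((Polynomial.Chebyshev.T ℝ (k : ℤ)).eval y : ℝ) : ℂ)

/-- The Chebyshev points `y_i = cos (i π / n)`, `0 ≤ i ≤ n`. -/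
def node (n i : ℕ) : ℝ := Real.cos (i * Real.pi / n)

/-- The polynomial of degree at most `n` that interpolates `h` at the Chebyshev points. -/
def chebInterp (h : ℝ → ℂ) (n : ℕ) (y : ℝ) : ℂ :=
  (Lagrange.interpolate (Finset.range (n + 1)) (fun i => (node n i : ℂ))
    (fun i => h (node n i))).eval (y : ℂ)

/-- `u` is the interpolant of `f` in `S_n` at the points `x_i = g(y_i; p)`. -/
def IsInterpolant (p : ℝ) (f : ℝ → ℂ) (n : ℕ) (u : ℝ → ℂ) : Prop :=
  u ∈ S p n ∧ ∀ i ≤ n, u (g p (node n i)) = f (g p (node n i))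

/-- The uniform distance of `u` and `v` on `[-1, 1]`. -/
def supDist (u v : ℝ → ℂ) : ℝ≥0∞ := ⨆ x ∈ Icc (-1 : ℝ) 1, ‖u x - v x‖ₑ

/-- The error of best uniform approximation of `f` on `[-1, 1]` from `S_n`. -/
def bestError (p : ℝ) (f : ℝ → ℂ) (n : ℕ) : ℝ≥0∞ := ⨅ u ∈ S p n, supDist f u

/-- The error of best uniform approximation of `h` on `[-1, 1]` by polynomials of degree `≤ n`. -/
def polyBestError (h : ℝ → ℂ) (n : ℕ) : ℝ≥0∞ :=
  ⨅ P ∈ Polynomial.degreeLE ℂ (n : WithBot ℕ), supDist h (fun y => P.eval (y : ℂ))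

/-- `|θ(z)|` for `θ(z) = z ± √(z² - 1)`. The two values of `θ` have product `1`; the maximum
selects the branch that maps the complement of `[-1, 1]` to the outside of the unit disc. -/
def level (z : ℂ) : ℝ :=
  max ‖z + (z ^ 2 - 1) ^ (1 / 2 : ℂ)‖ ‖z - (z ^ 2 - 1) ^ (1 / 2 : ℂ)‖

/-- The inside of the level curve `B_t = {z : |θ(z)| = t}` (an ellipse with foci `±1`). -/
def inside (t : ℝ) : Set ℂ := {z | level z < t}

/-- `h` on `[-1, 1]` is the restriction of a function that is analytic inside `B_t`. -/
def AnalyticInside (h : ℝ → ℂ) (t : ℝ) : Prop :=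
  ∃ F : ℂ → ℂ, AnalyticOnNhd ℂ F (inside t) ∧ ∀ y ∈ Icc (-1 : ℝ) 1, F y = h y

/-- `F`, given on `D`, has no analytic continuation from `D` to a neighbourhood of `s`. -/
def SingularAt (F : ℂ → ℂ) (D : Set ℂ) (s : ℂ) : Prop :=
  ¬ ∃ G : ℂ → ℂ, AnalyticAt ℂ G s ∧ ∀ᶠ z in 𝓝[D] s, G z = F z

/-- `limsup e_n ^ (1 / n) = r`. -/
def HasRate (e : ℕ → ℝ≥0∞) (r : ℝ) : Prop :=
  limsup (fun n : ℕ => e n ^ (1 / (n : ℝ))) atTop = ENNReal.ofReal r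

/-- `e_n ≤ c r ^ n` for all `n`, with a finite `c` that does not depend on `n`. -/
def GeomBound (e : ℕ → ℝ≥0∞) (r : ℝ) : Prop :=
  ∃ c : ℝ≥0, ∀ n : ℕ, e n ≤ c * ENNReal.ofReal r ^ n

end Nptp

end

/-!
The substitution `y = sin (p x) / sin p` maps `[-1, 1]` onto itself with inverse `g`, carries `S_n`
onto the polynomials of degree at most `n` (`mem_S_iff`) and the weight of `innerW` to a multiple of
the Chebyshev weight (`innerW_psi`). Hence projection, interpolation and best approximation of `f`
in `S_n` are those of `f̃` by polynomials, and the rates are given by Bernstein's theorem for `f̃`.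

The Chebyshev coefficients of `h` are, up to a factor, the Fourier coefficients of
`θ ↦ h (cos θ)` (`chebCoeff_eq_cosCoeff`, `fourierCoeff_cosLift`), and also the Laurent coefficients
of `w ↦ F ((w + 1 / w) / 2)`, where `F` is the analytic extension of `h`
(`circleIntegral_joukowski`). If `F` is analytic and bounded inside `B_ρ`, that function is analytic
in the annulus `1 / ρ < |w| < ρ`, so Cauchy's estimate gives coefficients of size `ρ ^ (-k)`
(`norm_cosCoeff_le`). The error of the projection is the tail of the Chebyshev series, and by
aliasing the error of the interpolant is at most twice the tail (`norm_sub_chebInterp_le`). If `F`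
is not bounded, a slightly smaller ellipse gives every rate larger than `1 / ρ`
(`geomBound_of_analytic`).

Conversely, the Chebyshev coefficient of index `n + 1` is at most twice the error of best
approximation of degree `n`. If these errors decayed faster than `ρ ^ (-n)`, the Chebyshev series
would converge inside some `B_t` with `t > ρ` (`exists_analyticInside_of_limsup_lt`), because
`|T_k(z)| ≤ |θ(z)| ^ k` (`norm_eval_T_le`). For `ρ = cot (p / 2)` the curve `B_ρ` passes through
`± 1 / sin p` (`level_one_div_sin`), and the singularity there excludes such an extension
(`le_level_of_singularAt`).
-/

namespace Nptp

/-! ### The Joukowski map and the insides of the level curves -/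

/-- The Joukowski map `w ↦ (w + 1 / w) / 2`, which carries the circles `|w| = t` and `|w| = 1 / t`
onto the level curve `B_t`. -/
noncomputable def joukowski (w : ℂ) : ℂ := (w + w⁻¹) / 2

lemma level_joukowski {w : ℂ} (hw : w ≠ 0) : level (joukowski w) = max ‖w‖ ‖w⁻¹‖ := by
  have hq : ((joukowski w ^ 2 - 1) ^ (1 / 2 : ℂ)) ^ 2 = ((w - w⁻¹) / 2) ^ 2 := by
    rw [one_div]
    have := Complex.cpow_nat_inv_pow (joukowski w ^ 2 - 1) (n := 2) two_ne_zero
    push_cast at this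
    rw [this, joukowski]
    field_simp
    ring
  -- the principal square root may be either of `± (w - 1 / w) / 2`; `level` does not see the sign
  rcases sq_eq_sq_iff_eq_or_eq_neg.mp hq with h | h
  · rw [level, h, joukowski]
    congr 2 <;> ring
  · rw [level, h, joukowski, max_comm]
    congr 2 <;> ring

/-- The two preimages `z ± √(z² - 1)` of `z` have product `1`, so one lies outside the open unit
disc. -/
lemma exists_joukowski (z : ℂ) : ∃ w : ℂ, w ≠ 0 ∧ joukowski w = z ∧ 1 ≤ ‖w‖ := by
  obtain ⟨q, hq⟩ : ∃ q : ℂ, q ^ 2 = z ^ 2 - 1 := IsAlgClosed.exists_pow_nat_eq _ two_pos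
  have h1 : (z + q) * (z - q) = 1 := by linear_combination -hq
  have hp : z + q ≠ 0 := left_ne_zero_of_mul_eq_one h1
  have hm : z - q ≠ 0 := right_ne_zero_of_mul_eq_one h1
  have hn : ‖z + q‖ * ‖z - q‖ = 1 := by rw [← norm_mul, h1, norm_one]
  rcases le_total 1 ‖z + q‖ with h | h
  · refine ⟨z + q, hp, ?_, h⟩
    rw [joukowski, inv_eq_of_mul_eq_one_right h1]
    ring
  · refine ⟨z - q, hm, ?_, ?_⟩
    · rw [joukowski, inv_eq_of_mul_eq_one_left h1]
      ring
    · by_contra! h'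
      nlinarith [norm_nonneg (z + q), norm_nonneg (z - q)]

lemma level_joukowski_of_one_le {w : ℂ} (hw : 1 ≤ ‖w‖) : level (joukowski w) = ‖w‖ := by
  rw [level_joukowski (norm_pos_iff.mp (by linarith)), norm_inv,
    max_eq_left ((inv_le_one_of_one_le₀ hw).trans hw)]

lemma one_le_level (z : ℂ) : 1 ≤ level z := by
  obtain ⟨w, -, rfl, hw1⟩ := exists_joukowski z
  rwa [level_joukowski_of_one_le hw1]

/-- On the level curve `B_t` the sum of the distances to the foci `±1` is `t + 1 / t`. -/
lemma level_add_inv (z : ℂ) : level z + (level z)⁻¹ = ‖z - 1‖ + ‖z + 1‖ := by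
  obtain ⟨w, hw, rfl, hw1⟩ := exists_joukowski z
  rw [level_joukowski_of_one_le hw1, joukowski]
  have hn : ‖w‖ ≠ 0 := norm_ne_zero_iff.mpr hw
  have e1 : (w + w⁻¹) / 2 - 1 = (w - 1) ^ 2 / (2 * w) := by field_simp; ring
  have e2 : (w + w⁻¹) / 2 + 1 = (w + 1) ^ 2 / (2 * w) := by field_simp; ring
  rw [e1, e2, norm_div, norm_div, norm_pow, norm_pow, norm_mul, Complex.norm_ofNat, ← add_div]
  have hpar := parallelogram_law_with_norm ℝ w 1
  rw [norm_one] at hpar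
  field_simp
  nlinarith [hpar]

lemma add_inv_lt_add_inv {a b : ℝ} (ha : 1 ≤ a) (hab : a < b) : a + a⁻¹ < b + b⁻¹ := by
  have ha0 : 0 < a := by linarith
  have hb0 : 0 < b := by linarith
  have hab1 : 1 < a * b := by nlinarith
  have : b + b⁻¹ - (a + a⁻¹) = (b - a) * (a * b - 1) / (a * b) := by field_simp; ring
  have : 0 < (b - a) * (a * b - 1) / (a * b) :=
    div_pos (mul_pos (by linarith) (by linarith)) (by linarith)
  linarith

lemma add_inv_lt_add_inv_iff {a b : ℝ} (ha : 1 ≤ a) (hb : 1 ≤ b) :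
    a + a⁻¹ < b + b⁻¹ ↔ a < b := by
  refine ⟨fun h => ?_, add_inv_lt_add_inv ha⟩
  by_contra! hba
  rcases hba.eq_or_lt with rfl | hlt
  · exact lt_irrefl _ h
  · exact lt_asymm h (add_inv_lt_add_inv hb hlt)

lemma mem_inside_iff {t : ℝ} (ht : 1 < t) {z : ℂ} :
    z ∈ inside t ↔ ‖z - 1‖ + ‖z + 1‖ < t + t⁻¹ := by
  rw [← level_add_inv, add_inv_lt_add_inv_iff (one_le_level z) ht.le]
  rfl

lemma inside_mono {s t : ℝ} (hst : s ≤ t) : inside s ⊆ inside t :=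
  fun _ hz => lt_of_lt_of_le hz hst

lemma isOpen_inside {t : ℝ} (ht : 1 < t) : IsOpen (inside t) := by
  have : inside t = {z | ‖z - 1‖ + ‖z + 1‖ < t + t⁻¹} := ext fun z => mem_inside_iff ht
  rw [this]
  exact isOpen_lt (by fun_prop) continuous_const

lemma convex_inside {t : ℝ} (ht : 1 < t) : Convex ℝ (inside t) := by
  have : inside t = {z ∈ univ | ‖z - 1‖ + ‖z + 1‖ < t + t⁻¹} := by
    ext z
    simp [mem_inside_iff ht]
  rw [this]
  refine ConvexOn.convex_lt ?_ _
  have h (c : ℂ) : ConvexOn ℝ univ fun z : ℂ => ‖z + c‖ := by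
    simpa [Function.comp_def] using
      (convexOn_norm (E := ℂ) convex_univ).translate_left c
  simpa [sub_eq_add_neg] using! (h (-1)).add (h 1)

lemma ofReal_mem_inside {t : ℝ} (ht : 1 < t) {y : ℝ} (hy : y ∈ Icc (-1 : ℝ) 1) :
    (y : ℂ) ∈ inside t := by
  rw [mem_inside_iff ht]
  have h1 : ‖(y : ℂ) - 1‖ = 1 - y := by
    rw [← Complex.ofReal_one, ← Complex.ofReal_sub, Complex.norm_real, Real.norm_eq_abs,
      abs_of_nonpos (by linarith [hy.2]), neg_sub]
  have h2 : ‖(y : ℂ) + 1‖ = y + 1 := by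
    rw [← Complex.ofReal_one, ← Complex.ofReal_add, Complex.norm_real, Real.norm_eq_abs,
      abs_of_nonneg (by linarith [hy.1])]
  have := add_inv_lt_add_inv le_rfl ht
  rw [h1, h2]
  norm_num at this
  linarith

lemma joukowski_mem_inside {t : ℝ} {w : ℂ} (hw : w ≠ 0) (h1 : ‖w‖ < t) (h2 : ‖w⁻¹‖ < t) :
    joukowski w ∈ inside t := by
  rw [inside, mem_ofPred_eq, level_joukowski hw]
  exact max_lt h1 h2

lemma level_neg (z : ℂ) : level (-z) = level z := by
  rw [level, level, neg_sq, max_comm, ← norm_neg (-z - _), ← norm_neg (-z + _)]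
  congr 2 <;> ring

/-- A function analytic inside `B_t` is bounded inside every smaller level curve, since the closed
ellipse that such a curve bounds is compact. -/
lemma exists_bound_inside {F : ℂ → ℂ} {s t : ℝ} (hs : 1 < s) (hst : s < t)
    (hF : AnalyticOnNhd ℂ F (inside t)) : ∃ M : ℝ, ∀ z ∈ inside s, ‖F z‖ ≤ M := by
  have hK : IsCompact {z : ℂ | ‖z - 1‖ + ‖z + 1‖ ≤ s + s⁻¹} := by
    refine Metric.isCompact_of_isClosed_isBounded
      (isClosed_le (by fun_prop) continuous_const)
      ((Metric.isBounded_closedBall (x := (1 : ℂ)) (r := s + s⁻¹)).subset fun z hz => ?_)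
    rw [mem_closedBall_iff_norm]
    exact le_trans (le_add_of_nonneg_right (norm_nonneg _)) hz
  have hKt : {z : ℂ | ‖z - 1‖ + ‖z + 1‖ ≤ s + s⁻¹} ⊆ inside t := fun z hz =>
    (mem_inside_iff (hs.trans hst)).mpr (lt_of_le_of_lt hz (add_inv_lt_add_inv hs.le hst))
  obtain ⟨M, hM⟩ := hK.exists_bound_of_continuousOn (hF.continuousOn.mono hKt)
  exact ⟨M, fun z hz => hM z ((mem_inside_iff hs).mp hz).le⟩

/-- Identity theorem: two functions that are analytic inside `B_t` and agree on `[-1, 1]` agree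
inside `B_t`. -/
lemma eqOn_inside {F G : ℂ → ℂ} {t : ℝ} (ht : 1 < t) (hF : AnalyticOnNhd ℂ F (inside t))
    (hG : AnalyticOnNhd ℂ G (inside t)) (hFG : ∀ y ∈ Icc (-1 : ℝ) 1, F y = G y) :
    EqOn F G (inside t) := by
  have h0 : (0 : ℂ) ∈ inside t := by
    simpa using ofReal_mem_inside ht (y := 0) (by norm_num)
  refine hF.eqOn_of_preconnected_of_frequently_eq hG (convex_inside ht).isPreconnected h0 ?_
  have hmap : Tendsto (fun y : ℝ => (y : ℂ)) (𝓝[≠] 0) (𝓝[≠] 0) := by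
    refine tendsto_nhdsWithin_iff.mpr ⟨?_, ?_⟩
    · have : Tendsto (fun y : ℝ => (y : ℂ)) (𝓝 0) (𝓝 0) := by
        simpa using Complex.continuous_ofReal.tendsto 0
      exact this.mono_left nhdsWithin_le_nhds
    · filter_upwards [self_mem_nhdsWithin] with y hy
      simpa using hy
  refine hmap.frequently (Eventually.frequently ?_)
  filter_upwards [nhdsWithin_le_nhds (Icc_mem_nhds (by norm_num : (-1 : ℝ) < 0) one_pos)] with y hy
  exact hFG y hy

/-! ### Chebyshev polynomials in the complex plane -/

open Polynomial in
lemma eval_T_joukowski (k : ℕ) {w : ℂ} (hw : w ≠ 0) :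
    (Chebyshev.T ℂ (k : ℤ)).eval (joukowski w) = (w ^ k + (w ^ k)⁻¹) / 2 := by
  have h (v : ℂ) : (Complex.exp v + (Complex.exp v)⁻¹) / 2 = Complex.cosh v := by
    rw [← Complex.exp_neg, Complex.cosh]
  obtain ⟨u, rfl⟩ : ∃ u, Complex.exp u = w := ⟨_, Complex.exp_log hw⟩
  rw [joukowski, h, Chebyshev.T_complex_cosh, ← Complex.exp_nat_mul, h]
  simp

/-- Bernstein's inequality `|T_k(z)| ≤ |θ(z)| ^ k`. -/
lemma norm_eval_T_le (k : ℕ) (z : ℂ) :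
    ‖(Polynomial.Chebyshev.T ℂ (k : ℤ)).eval z‖ ≤ level z ^ k := by
  obtain ⟨w, hw, rfl, hw1⟩ := exists_joukowski z
  rw [eval_T_joukowski k hw, level_joukowski_of_one_le hw1, norm_div, Complex.norm_ofNat]
  have h1 : 1 ≤ ‖w‖ ^ k := one_le_pow₀ hw1
  have h2 : ‖(w ^ k)⁻¹‖ ≤ ‖w‖ ^ k := by
    rw [norm_inv, norm_pow]
    exact (inv_le_one_of_one_le₀ h1).trans h1
  have h3 := norm_add_le (w ^ k) (w ^ k)⁻¹
  rw [norm_pow] at h3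
  linarith

/-! ### Chebyshev coefficients as Fourier coefficients -/

/-- The substitution `y = cos θ`. Since `arccos` is monotone, no regularity of `Q` is needed. -/
lemma integral_div_sqrt_eq_integral_cos (Q : ℝ → ℂ) :
    ∫ y in (-1 : ℝ)..1, Q y * ((√(1 - y ^ 2))⁻¹ : ℝ) = ∫ θ in (0 : ℝ)..Real.pi, Q (Real.cos θ) := by
  have key := intervalIntegral.integral_deriv_smul_comp_of_deriv_nonpos (a := -1) (b := 1)
    (f := Real.arccos) (f' := fun x => -(1 / √(1 - x ^ 2))) (g := fun θ => Q (Real.cos θ))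
    (by fun_prop)
    (fun x hx => Real.hasDerivAt_arccos (by simp at hx; linarith) (by simp at hx; linarith))
    (fun x _ => by simp)
  rw [Real.arccos_neg_one, Real.arccos_one, intervalIntegral.integral_symm 0 Real.pi] at key
  rw [← neg_inj, ← key, ← intervalIntegral.integral_neg]
  refine intervalIntegral.integral_congr fun x hx => ?_
  rw [uIcc_of_le (by norm_num)] at hx
  simp only [Function.comp_apply, Real.cos_arccos hx.1 hx.2, Complex.real_smul]
  push_cast
  ring

/-- The `n`-th Fourier coefficient `(1 / π) ∫_0^π h (cos θ) cos (n θ) dθ` of the even function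
`θ ↦ h (cos θ)`. -/
noncomputable def cosCoeff (h : ℝ → ℂ) (n : ℤ) : ℂ :=
  (Real.pi : ℂ)⁻¹ * ∫ θ in (0 : ℝ)..Real.pi, h (Real.cos θ) * (Real.cos (n * θ) : ℂ)

lemma cosCoeff_neg (h : ℝ → ℂ) (n : ℤ) : cosCoeff h (-n) = cosCoeff h n := by
  simp [cosCoeff]

lemma chebCoeff_eq_cosCoeff (h : ℝ → ℂ) (k : ℕ) :
    chebCoeff h k = 2 / (if k = 0 then 2 else 1) * cosCoeff h k := by
  have := integral_div_sqrt_eq_integral_cos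
    fun y => h y * (((Polynomial.Chebyshev.T ℝ (k : ℤ)).eval y : ℝ) : ℂ)
  simp only [Polynomial.Chebyshev.T_real_cos] at this
  rw [chebCoeff, cosCoeff, ← this, div_mul_eq_div_div, div_eq_mul_inv _ (Real.pi : ℂ), mul_assoc]
  congr 2
  refine intervalIntegral.integral_congr fun y _ => ?_
  push_cast
  ring

lemma continuous_comp_cos {h : ℝ → ℂ} (hh : ContinuousOn h (Icc (-1) 1)) :
    Continuous fun θ : ℝ => h (Real.cos θ) :=
  hh.comp_continuous Real.continuous_cos fun θ => Real.cos_mem_Icc θ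

/-- The function `θ ↦ h (cos θ)` on the circle `ℝ / 2πℤ`. -/
noncomputable def cosLift (h : ℝ → ℂ) (hh : ContinuousOn h (Icc (-1) 1)) :
    C(AddCircle (2 * Real.pi), ℂ) where
  toFun θ := h (Real.Angle.cos θ)
  continuous_toFun := hh.comp_continuous Real.Angle.continuous_cos fun θ => by
    induction θ using Real.Angle.induction_on with
    | h x => exact Real.cos_mem_Icc x

lemma cosLift_coe {h : ℝ → ℂ} (hh : ContinuousOn h (Icc (-1) 1)) (θ : ℝ) :
    cosLift h hh (θ : AddCircle (2 * Real.pi)) = h (Real.cos θ) := rfl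

lemma fourier_coe_two_pi (n : ℤ) (θ : ℝ) :
    fourier n (θ : AddCircle (2 * Real.pi)) = Complex.exp (n * θ * Complex.I) := by
  rw [fourier_coe_apply]
  congr 1
  have : (Real.pi : ℂ) ≠ 0 := Complex.ofReal_ne_zero.mpr Real.pi_ne_zero
  push_cast
  field_simp

lemma fourierCoeff_cosLift {h : ℝ → ℂ} (hh : ContinuousOn h (Icc (-1) 1)) (n : ℤ) :
    haveI : Fact (0 < 2 * Real.pi) := ⟨Real.two_pi_pos⟩
    fourierCoeff (cosLift h hh) n = cosCoeff h n := by
  have : Fact (0 < 2 * Real.pi) := ⟨Real.two_pi_pos⟩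
  have hc := continuous_comp_cos hh
  rw [fourierCoeff_eq_intervalIntegral _ n (-Real.pi), cosCoeff]
  have e : -Real.pi + 2 * Real.pi = Real.pi := by ring
  simp only [cosLift_coe, fourier_coe_two_pi, e, smul_eq_mul]
  set q : ℝ → ℂ := fun θ => Complex.exp (((-n : ℤ) : ℂ) * θ * Complex.I) * h (Real.cos θ) with hq
  have hqc : Continuous q := Continuous.mul (by fun_prop) hc
  have hqn : Continuous fun θ => q (-θ) := hqc.comp continuous_neg
  have hneg := intervalIntegral.integral_comp_neg (a := 0) (b := Real.pi) q
  rw [neg_zero] at hneg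
  change (1 / (2 * Real.pi)) • ∫ θ in -Real.pi..Real.pi, q θ = _
  -- fold the integral over `[-π, 0]` onto `[0, π]`
  rw [← intervalIntegral.integral_add_adjacent_intervals (b := 0)
    (hqc.intervalIntegrable _ _) (hqc.intervalIntegrable _ _), ← hneg,
    ← intervalIntegral.integral_add (hqn.intervalIntegrable _ _)
      (hqc.intervalIntegrable _ _)]
  have : ∀ θ : ℝ, q (-θ) + q θ = 2 * (h (Real.cos θ) * (Real.cos (n * θ) : ℂ)) := by
    intro θ
    simp only [hq, Real.cos_neg]
    push_cast
    rw [Complex.cos]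
    ring_nf
  simp only [this]
  rw [intervalIntegral.integral_const_mul, Complex.real_smul]
  have : (Real.pi : ℂ) ≠ 0 := Complex.ofReal_ne_zero.mpr Real.pi_ne_zero
  push_cast
  field_simp

/-- A continuous function is the sum of its Chebyshev series if the Chebyshev coefficients are
summable: this is the corresponding statement on the Fourier series of `θ ↦ h (cos θ)`. -/
lemma hasSum_chebyshev {h : ℝ → ℂ} (hh : ContinuousOn h (Icc (-1) 1))
    (hs : Summable fun k : ℕ => cosCoeff h k) {y : ℝ} (hy : y ∈ Icc (-1 : ℝ) 1) :
    HasSum (fun k : ℕ =>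
      chebCoeff h k * (((Polynomial.Chebyshev.T ℝ (k : ℤ)).eval y : ℝ) : ℂ)) (h y) := by
  have : Fact (0 < 2 * Real.pi) := ⟨Real.two_pi_pos⟩
  obtain ⟨θ, rfl⟩ : ∃ θ, Real.cos θ = y := ⟨_, Real.cos_arccos hy.1 hy.2⟩
  have hsum : Summable (fourierCoeff (cosLift h hh)) := by
    have : fourierCoeff (cosLift h hh) = cosCoeff h := funext (fourierCoeff_cosLift hh)
    rw [this]
    refine Summable.of_nat_of_neg hs ?_
    simpa only [cosCoeff_neg] using hs
  have h1 := (has_pointwise_sum_fourier_series_of_summable hsum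
    (θ : AddCircle (2 * Real.pi))).nat_add_neg
  -- pairing `n` with `-n` counts the term of index `0` twice
  have h2 := h1.sub (hasSum_ite_eq (0 : ℕ) (cosCoeff h 0))
  simp only [fourierCoeff_cosLift, cosLift_coe, fourier_coe_two_pi, cosCoeff_neg, smul_eq_mul] at h2
  have e0 : h (Real.cos θ) + cosCoeff h 0 * Complex.exp ((0 : ℤ) * θ * Complex.I) -
      cosCoeff h 0 = h (Real.cos θ) := by simp
  rw [e0] at h2
  refine (congrArg (fun q : ℕ → ℂ => HasSum q (h (Real.cos θ))) (funext fun k => ?_)).mpr h2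
  rw [chebCoeff_eq_cosCoeff, Polynomial.Chebyshev.T_real_cos]
  push_cast
  rcases eq_or_ne k 0 with rfl | hk
  · simp
  · rw [if_neg hk, if_neg hk, Complex.cos]
    ring_nf

/-! ### Bounds for the Chebyshev coefficients -/

lemma joukowski_circleMap (θ : ℝ) : joukowski (circleMap 0 1 θ) = (Real.cos θ : ℂ) := by
  rw [joukowski, circleMap, Complex.ofReal_one, one_mul, zero_add, ← Complex.exp_neg,
    Complex.ofReal_cos, Complex.cos, neg_mul]

/-- The coefficient of `w ^ n` in the Laurent expansion of `w ↦ F (joukowski w)` is the Fourier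
coefficient of `θ ↦ F (cos θ)`. -/
lemma circleIntegral_joukowski {h : ℝ → ℂ} {F : ℂ → ℂ} (hh : ContinuousOn h (Icc (-1) 1))
    (hFh : ∀ y ∈ Icc (-1 : ℝ) 1, F y = h y) (n : ℕ) :
    (∮ w in C(0, 1), w⁻¹ * ((w ^ n)⁻¹ * F (joukowski w))) =
      2 * Real.pi * Complex.I * cosCoeff h n := by
  have : Fact (0 < 2 * Real.pi) := ⟨Real.two_pi_pos⟩
  rw [← fourierCoeff_cosLift hh, fourierCoeff_eq_intervalIntegral _ _ 0, circleIntegral,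
    zero_add]
  have : ∀ θ : ℝ, deriv (circleMap 0 1) θ • ((circleMap 0 1 θ)⁻¹ *
      ((circleMap 0 1 θ ^ n)⁻¹ * F (joukowski (circleMap 0 1 θ)))) =
      Complex.I * (fourier (-(n : ℤ)) (θ : AddCircle (2 * Real.pi)) •
        cosLift h hh (θ : AddCircle (2 * Real.pi))) := by
    intro θ
    have hne : circleMap 0 1 θ ≠ 0 := circleMap_ne_center one_ne_zero
    rw [cosLift_coe, joukowski_circleMap, hFh _ (Real.cos_mem_Icc θ), fourier_coe_two_pi,
      deriv_circleMap, smul_eq_mul, smul_eq_mul]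
    have e : (circleMap 0 1 θ ^ n)⁻¹ =
        Complex.exp (((-(n : ℤ) : ℤ) : ℂ) * θ * Complex.I) := by
      rw [circleMap, Complex.ofReal_one, one_mul, zero_add, ← Complex.exp_nat_mul,
        ← Complex.exp_neg]
      congr 1
      push_cast
      ring
    rw [e]
    field_simp
  simp only [this]
  rw [intervalIntegral.integral_const_mul, Complex.real_smul]
  have : (Real.pi : ℂ) ≠ 0 := Complex.ofReal_ne_zero.mpr Real.pi_ne_zero
  push_cast
  field_simp

/-- Cauchy's estimate for the Laurent coefficients of `w ↦ F (joukowski w)`, which is analytic in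
the annulus `1 / ρ < |w| < ρ`. -/
lemma norm_cosCoeff_le {h : ℝ → ℂ} {F : ℂ → ℂ} {ρ M : ℝ} (hρ : 1 < ρ)
    (hF : AnalyticOnNhd ℂ F (inside ρ)) (hM : ∀ z ∈ inside ρ, ‖F z‖ ≤ M)
    (hFh : ∀ y ∈ Icc (-1 : ℝ) 1, F y = h y) (hh : ContinuousOn h (Icc (-1) 1)) (n : ℕ) :
    ‖cosCoeff h n‖ ≤ M * (ρ⁻¹) ^ n := by
  have hmem : ∀ w : ℂ, 1 ≤ ‖w‖ → ‖w‖ < ρ → w ≠ 0 ∧ joukowski w ∈ inside ρ := by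
    intro w h1 h2
    have hw : w ≠ 0 := norm_pos_iff.mp (by linarith)
    refine ⟨hw, joukowski_mem_inside hw h2 ?_⟩
    rw [norm_inv]
    exact (inv_le_one_of_one_le₀ h1).trans_lt hρ
  -- `F ∘ joukowski` need not extend to the circle `|w| = ρ`: integrate over `|w| = R < ρ`, and let
  -- `R → ρ` at the end
  have hR : ∀ R : ℝ, 1 < R → R < ρ → ‖cosCoeff h n‖ ≤ M * (R⁻¹) ^ n := by
    intro R h1 h2
    have hd : ∀ w : ℂ, 1 ≤ ‖w‖ → ‖w‖ < ρ →
        DifferentiableAt ℂ (fun w => (w ^ n)⁻¹ * F (joukowski w)) w := by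
      intro w hw1 hw2
      obtain ⟨hw, hwi⟩ := hmem w hw1 hw2
      have hj : DifferentiableAt ℂ joukowski w := by
        unfold joukowski
        exact (differentiableAt_id.add (differentiableAt_inv hw)).div_const 2
      exact ((differentiableAt_id.pow n).fun_inv (pow_ne_zero n hw)).mul
        ((hF _ hwi).differentiableAt.comp w hj)
    have key := Complex.circleIntegral_sub_center_inv_smul_eq_of_differentiable_on_annulus_off_countable
      (c := 0) one_pos h1.le (f := fun w => (w ^ n)⁻¹ * F (joukowski w)) countable_empty
      (fun w hw => (hd w (by simpa using hw.2)
        (lt_of_le_of_lt (by simpa using hw.1) h2)).continuousAt.continuousWithinAt)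
      (fun w hw => hd w (by simpa using (le_of_lt (by simpa using hw.1.2 : 1 < ‖w‖)))
        ((by simpa using hw.1.1 : ‖w‖ < R).trans h2))
    simp only [sub_zero, smul_eq_mul] at key
    rw [circleIntegral_joukowski hh hFh] at key
    have hb := circleIntegral.norm_integral_le_of_norm_le_const (c := 0) (R := R)
      (C := R⁻¹ * ((R ^ n)⁻¹ * M)) (f := fun w => w⁻¹ * ((w ^ n)⁻¹ * F (joukowski w)))
      (by linarith) (fun w hw => by
        have hw' : ‖w‖ = R := by simpa using hw
        rw [norm_mul, norm_mul, norm_inv, norm_inv, norm_pow, hw']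
        have := hM _ (hmem w (by linarith) (by linarith)).2
        have : (0 : ℝ) < R := by linarith
        gcongr)
    rw [key, norm_mul, norm_mul, norm_mul, Complex.norm_I, Complex.norm_ofNat, Complex.norm_real,
      Real.norm_of_nonneg Real.pi_pos.le] at hb
    have hR0 : (0 : ℝ) < R := by linarith
    have e : 2 * Real.pi * R * (R⁻¹ * ((R ^ n)⁻¹ * M)) = 2 * Real.pi * (M * (R⁻¹) ^ n) := by
      rw [inv_pow]
      field_simp
    rw [e, mul_one] at hb
    exact le_of_mul_le_mul_left hb (by positivity)
  have ht : Tendsto (fun R : ℝ => M * (R⁻¹) ^ n) (𝓝[<] ρ) (𝓝 (M * (ρ⁻¹) ^ n)) := by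
    have : ContinuousAt (fun R : ℝ => M * (R⁻¹) ^ n) ρ :=
      continuousAt_const.mul ((continuousAt_inv₀ (by linarith)).pow n)
    exact this.tendsto.mono_left nhdsWithin_le_nhds
  refine ge_of_tendsto ht ?_
  filter_upwards [Ioo_mem_nhdsLT hρ] with R hR'
  exact hR R hR'.1 hR'.2

lemma norm_chebCoeff_le_two_mul (h : ℝ → ℂ) (k : ℕ) :
    ‖chebCoeff h k‖ ≤ 2 * ‖cosCoeff h k‖ := by
  rw [chebCoeff_eq_cosCoeff, norm_mul]
  gcongr
  split_ifs <;> simp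

lemma norm_cosCoeff_le_norm_chebCoeff (h : ℝ → ℂ) (k : ℕ) :
    ‖cosCoeff h k‖ ≤ ‖chebCoeff h k‖ := by
  rw [chebCoeff_eq_cosCoeff, norm_mul]
  refine le_mul_of_one_le_left (norm_nonneg _) ?_
  split_ifs <;> simp

lemma norm_cosCoeff_le_of_le {h : ℝ → ℂ} {ε : ℝ} (hε : ∀ y ∈ Icc (-1 : ℝ) 1, ‖h y‖ ≤ ε) (n : ℤ) :
    ‖cosCoeff h n‖ ≤ ε := by
  have hb := intervalIntegral.norm_integral_le_of_norm_le_const (a := 0) (b := Real.pi) (C := ε)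
    (f := fun θ : ℝ => h (Real.cos θ) * (Real.cos (n * θ) : ℂ)) (fun θ _ => by
      rw [norm_mul, Complex.norm_real]
      exact (mul_le_of_le_one_right (norm_nonneg _) (Real.abs_cos_le_one _)).trans
        (hε _ (Real.cos_mem_Icc θ)))
  rw [cosCoeff, norm_mul, norm_inv, Complex.norm_real, Real.norm_of_nonneg Real.pi_pos.le]
  rw [sub_zero, abs_of_pos Real.pi_pos] at hb
  calc _ ≤ Real.pi⁻¹ * (ε * Real.pi) := by gcongr
    _ = ε := by field_simp

/-! ### Polynomials of degree at most `n` -/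

open Polynomial in
lemma span_chebyshev_eq_degreeLE (n : ℕ) :
    Submodule.span ℂ ((fun k : ℕ => Chebyshev.T ℂ (k : ℤ)) '' Iic n) = degreeLE ℂ n := by
  let T : Polynomial.Sequence ℂ := ⟨fun k => Chebyshev.T ℂ k, fun k => by
    rw [Chebyshev.degree_T, Int.natAbs_natCast]⟩
  exact T.span_degreeLE fun k _ => (leadingCoeff_ne_zero.mpr (T.ne_zero k)).isUnit

open Polynomial in
/-- Orthogonality of the Chebyshev polynomials, in terms of the Fourier coefficients. -/
lemma cosCoeff_eval_T {j k : ℕ} (hjk : j ≠ k) :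
    cosCoeff (fun y => (Chebyshev.T ℂ (j : ℤ)).eval (y : ℂ)) k = 0 := by
  have h0 := Chebyshev.integral_eval_T_real_mul_eval_T_real_measureT_of_ne hjk
  rw [Chebyshev.integral_measureT_eq_integral_cos] at h0
  rw [cosCoeff, mul_eq_zero]
  right
  refine Eq.trans ?_ (congrArg Complex.ofReal h0)
  rw [← intervalIntegral.integral_ofReal]
  refine intervalIntegral.integral_congr fun θ _ => ?_
  simp only [Chebyshev.T_real_cos, ← Chebyshev.complex_ofReal_eval_T]
  push_cast
  rfl

lemma cosCoeff_add {h₁ h₂ : ℝ → ℂ} (hh₁ : ContinuousOn h₁ (Icc (-1) 1))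
    (hh₂ : ContinuousOn h₂ (Icc (-1) 1)) (n : ℤ) :
    cosCoeff (fun y => h₁ y + h₂ y) n = cosCoeff h₁ n + cosCoeff h₂ n := by
  have hc₁ := continuous_comp_cos hh₁
  have hc₂ := continuous_comp_cos hh₂
  rw [cosCoeff, cosCoeff, cosCoeff, ← mul_add, ← intervalIntegral.integral_add]
  · simp only [add_mul]
  · exact (hc₁.mul (by fun_prop)).intervalIntegrable _ _
  · exact (hc₂.mul (by fun_prop)).intervalIntegrable _ _

lemma cosCoeff_const_mul (c : ℂ) (h : ℝ → ℂ) (n : ℤ) :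
    cosCoeff (fun y => c * h y) n = c * cosCoeff h n := by
  simp only [cosCoeff, mul_assoc]
  rw [intervalIntegral.integral_const_mul, mul_left_comm]

open Polynomial in
lemma cosCoeff_eval_of_degree_le {P : ℂ[X]} {n k : ℕ} (hP : P ∈ degreeLE ℂ n) (hk : n < k) :
    cosCoeff (fun y => P.eval (y : ℂ)) k = 0 := by
  rw [← span_chebyshev_eq_degreeLE] at hP
  induction hP using Submodule.span_induction with
  | mem Q hQ =>
    obtain ⟨j, hj, rfl⟩ := hQ
    exact cosCoeff_eval_T (lt_of_le_of_lt hj hk).ne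
  | zero => simp [cosCoeff]
  | add Q R _ _ hQ hR =>
    simp only [eval_add]
    rw [cosCoeff_add (by fun_prop) (by fun_prop), hQ, hR, add_zero]
  | smul c Q _ hQ =>
    simp only [eval_smul, smul_eq_mul]
    rw [cosCoeff_const_mul, hQ, mul_zero]

open Polynomial in
/-- The Chebyshev coefficients of index above `n` are bounded by twice the uniform distance to
any polynomial of degree at most `n`, since they do not change if that polynomial is subtracted. -/
lemma norm_chebCoeff_le_of_degree_le {h : ℝ → ℂ} (hh : ContinuousOn h (Icc (-1) 1)) {P : ℂ[X]}
    {n k : ℕ} (hP : P ∈ degreeLE ℂ n) (hk : n < k) {ε : ℝ}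
    (hε : ∀ y ∈ Icc (-1 : ℝ) 1, ‖h y - P.eval (y : ℂ)‖ ≤ ε) : ‖chebCoeff h k‖ ≤ 2 * ε := by
  refine (norm_chebCoeff_le_two_mul h k).trans ?_
  have hPc : ContinuousOn (fun y : ℝ => P.eval (y : ℂ)) (Icc (-1) 1) := by fun_prop
  have e : cosCoeff h k = cosCoeff (fun y => h y - P.eval (y : ℂ)) k := by
    have := cosCoeff_add (hh.sub hPc) hPc k
    simp only [Pi.sub_apply, sub_add_cancel] at this
    rw [this, cosCoeff_eval_of_degree_le hP hk, add_zero]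
    rfl
  rw [e]
  gcongr
  exact norm_cosCoeff_le_of_le hε k

/-! ### Interpolation at the Chebyshev points -/

lemma node_mem_Icc (n i : ℕ) : node n i ∈ Icc (-1 : ℝ) 1 := Real.cos_mem_Icc _

/-- The points `y_0, …, y_n` are distinct; for `n = 0` there is only the point `y_0 = 1`. -/
lemma injOn_node (n : ℕ) :
    InjOn (fun i => (node n i : ℂ)) (Finset.range (n + 1) : Finset ℕ) := by
  intro i hi j hj hij
  simp only [Finset.coe_range, mem_Iio] at hi hj
  rcases Nat.eq_zero_or_pos n with rfl | hn
  · omega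
  have hn' : (0 : ℝ) < n := by exact_mod_cast hn
  have hmem : ∀ m : ℕ, m < n + 1 → m * Real.pi / n ∈ Icc 0 Real.pi := fun m hm => by
    have : (m : ℝ) ≤ n := by exact_mod_cast Nat.lt_succ_iff.mp hm
    refine ⟨by positivity, ?_⟩
    rw [div_le_iff₀ hn', mul_comm]
    exact mul_le_mul_of_nonneg_left this Real.pi_pos.le
  have h := Real.injOn_cos (hmem i hi) (hmem j hj) (Complex.ofReal_injective hij)
  rw [div_left_inj' hn'.ne', mul_left_inj' Real.pi_ne_zero] at h
  exact_mod_cast h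

/-- Aliasing: on the Chebyshev points every `T_k` coincides with some `T_m`, `m ≤ n`. -/
lemma exists_eval_T_node_eq (n k : ℕ) : ∃ m ≤ n, (k ≤ n → m = k) ∧
    ∀ i, (Polynomial.Chebyshev.T ℝ (k : ℤ)).eval (node n i) =
      (Polynomial.Chebyshev.T ℝ (m : ℤ)).eval (node n i) := by
  simp only [node, Polynomial.Chebyshev.T_real_cos]
  rcases Nat.eq_zero_or_pos n with rfl | hn
  · -- here all the points are `cos 0`, because division by zero gives zero
    exact ⟨0, le_rfl, fun h => by omega, fun i => by simp⟩
  have hn' : (n : ℝ) ≠ 0 := by exact_mod_cast hn.ne'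
  have hk : (k : ℝ) = 2 * n * (k / (2 * n) : ℕ) + (k % (2 * n) : ℕ) := by
    exact_mod_cast (Nat.div_add_mod k (2 * n)).symm
  have hlt : k % (2 * n) < 2 * n := Nat.mod_lt _ (by omega)
  -- `cos (k i π / n)` depends only on `k` modulo `2n`, and only up to sign
  have hcos (i : ℕ) : Real.cos (((k : ℤ) : ℝ) * (i * Real.pi / n)) =
      Real.cos ((k % (2 * n) : ℕ) * (i * Real.pi / n)) := by
    rw [← Real.cos_add_nat_mul_two_pi ((k % (2 * n) : ℕ) * (i * Real.pi / n)) (k / (2 * n) * i),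
      Int.cast_natCast, hk]
    congr 1
    push_cast
    field_simp
    ring
  rcases le_or_gt (k % (2 * n)) n with h | h
  · exact ⟨k % (2 * n), h, fun hkn => Nat.mod_eq_of_lt (by omega), fun i => by
      rw [hcos, Int.cast_natCast]⟩
  · refine ⟨2 * n - k % (2 * n), by omega, fun hkn => ?_, fun i => ?_⟩
    · rw [Nat.mod_eq_of_lt (by omega)] at h
      omega
    · rw [hcos, Int.cast_natCast, Nat.cast_sub hlt.le, ← Real.cos_nat_mul_two_pi_sub _ i]
      congr 1
      push_cast
      field_simp

open Polynomial in
lemma eq_chebInterp {h : ℝ → ℂ} {n : ℕ} {P : ℂ[X]} (hP : P ∈ degreeLE ℂ n)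
    (hPh : ∀ i ≤ n, P.eval (node n i : ℂ) = h (node n i)) (y : ℝ) :
    P.eval (y : ℂ) = chebInterp h n y := by
  rw [chebInterp, ← Lagrange.eq_interpolate_of_eval_eq (f := P) _ (injOn_node n)]
  · rw [Finset.card_range]
    exact lt_of_le_of_lt (mem_degreeLE.mp hP) (by exact_mod_cast Nat.lt_succ_self n)
  · exact fun i hi => hPh i (Nat.lt_succ_iff.mp (Finset.mem_range.mp hi))

open Polynomial in
lemma chebInterp_eq_sum (h : ℝ → ℂ) (n : ℕ) (y : ℝ) :
    chebInterp h n y = ∑ i ∈ Finset.range (n + 1), h (node n i) *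
      (Lagrange.basis (Finset.range (n + 1)) (fun i => (node n i : ℂ)) i).eval (y : ℂ) := by
  simp [chebInterp, Lagrange.interpolate_apply, eval_finsetSum]

open Polynomial in
lemma T_mem_degreeLE {m n : ℕ} (hmn : m ≤ n) : Chebyshev.T ℂ (m : ℤ) ∈ degreeLE ℂ n := by
  rw [mem_degreeLE, Chebyshev.degree_T, Int.natAbs_natCast]
  exact_mod_cast hmn

/-! ### The errors of projection and interpolation -/

lemma norm_eval_T_real_le (k : ℕ) {y : ℝ} (hy : y ∈ Icc (-1 : ℝ) 1) :
    ‖(((Polynomial.Chebyshev.T ℝ (k : ℤ)).eval y : ℝ) : ℂ)‖ ≤ 1 := by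
  rw [Complex.norm_real]
  exact Polynomial.Chebyshev.abs_eval_T_real_le_one k (abs_le.mpr hy)

section Series

variable {h : ℝ → ℂ} {B q : ℝ}

lemma summable_cosCoeff (hq0 : 0 ≤ q) (hq : q < 1) (hB : ∀ k, ‖chebCoeff h k‖ ≤ B * q ^ k) :
    Summable fun k : ℕ => cosCoeff h k :=
  Summable.of_norm_bounded ((summable_geometric_of_lt_one hq0 hq).mul_left B)
    fun k => (norm_cosCoeff_le_norm_chebCoeff h k).trans (hB k)

lemma norm_sub_chebProj_le (hh : ContinuousOn h (Icc (-1) 1)) (hq0 : 0 ≤ q) (hq : q < 1)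
    (hB : ∀ k, ‖chebCoeff h k‖ ≤ B * q ^ k) (n : ℕ) {y : ℝ} (hy : y ∈ Icc (-1 : ℝ) 1) :
    ‖h y - chebProj h n y‖ ≤ B * q ^ (n + 1) / (1 - q) := by
  rw [norm_sub_rev]
  refine norm_sub_le_of_geometric_bound_of_hasSum hq (fun k => ?_)
    (hasSum_chebyshev hh (summable_cosCoeff hq0 hq hB) hy) (n + 1)
  rw [norm_mul]
  exact (mul_le_of_le_one_right (norm_nonneg _) (norm_eval_T_real_le k hy)).trans (hB k)

/-- By aliasing, interpolation replaces each `T_k` in the Chebyshev series of `h` by some `T_m`,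
`m ≤ n`, and leaves `T_0, …, T_n` alone; so the error is at most twice the tail of the series. -/
lemma norm_sub_chebInterp_le (hh : ContinuousOn h (Icc (-1) 1)) (hq0 : 0 ≤ q) (hq : q < 1)
    (hB : ∀ k, ‖chebCoeff h k‖ ≤ B * q ^ k) (n : ℕ) {y : ℝ} (hy : y ∈ Icc (-1 : ℝ) 1) :
    ‖h y - chebInterp h n y‖ ≤ 2 * B * q ^ (n + 1) / (1 - q) := by
  have hs := summable_cosCoeff hq0 hq hB
  choose m hmn hmk hmT using exists_eval_T_node_eq n
  let T : ℕ → ℝ → ℂ := fun k y => (((Polynomial.Chebyshev.T ℝ (k : ℤ)).eval y : ℝ) : ℂ)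
  have hinterp : HasSum (fun k => chebCoeff h k * T (m k) y) (chebInterp h n y) := by
    rw [chebInterp_eq_sum]
    have := hasSum_sum (s := Finset.range (n + 1)) fun i _ =>
      (hasSum_chebyshev hh hs (node_mem_Icc n i)).mul_right
        ((Lagrange.basis (Finset.range (n + 1)) (fun i => (node n i : ℂ)) i).eval (y : ℂ))
    refine (congrArg (fun q : ℕ → ℂ => HasSum q _) (funext fun k => ?_)).mpr this
    simp only [hmT k, mul_assoc]
    rw [← Finset.mul_sum, ← chebInterp_eq_sum (T (m k))]
    simp only [T, Polynomial.Chebyshev.complex_ofReal_eval_T]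
    rw [eq_chebInterp (h := fun y => (Polynomial.Chebyshev.T ℂ (m k : ℤ)).eval (y : ℂ))
      (T_mem_degreeLE (hmn k)) fun i _ => rfl]
  have hdiff := (hasSum_chebyshev hh hs hy).sub hinterp
  have hb := norm_sub_le_of_geometric_bound_of_hasSum (C := 2 * B) hq (fun k => ?_) hdiff (n + 1)
  · rw [Finset.sum_eq_zero, zero_sub, norm_neg] at hb
    · exact hb
    · intro k hk
      simp only [T]
      rw [hmk k (Nat.lt_succ_iff.mp (Finset.mem_range.mp hk)), sub_self]
  · rw [← mul_sub, norm_mul]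
    calc _ ≤ B * q ^ k * (1 + 1) := by
          refine mul_le_mul (hB k) ?_ (norm_nonneg _) ((norm_nonneg _).trans (hB k))
          exact (norm_sub_le _ _).trans
            (add_le_add (norm_eval_T_real_le k hy) (norm_eval_T_real_le (m k) hy))
      _ = 2 * B * q ^ k := by ring

/-- A function whose Chebyshev coefficients decay like `q ^ k` is analytic inside `B_t` for
`t < 1 / q`: its Chebyshev series converges uniformly there. -/
lemma analyticInside_of_norm_chebCoeff_le (hh : ContinuousOn h (Icc (-1) 1)) (hq0 : 0 ≤ q)
    (hB : ∀ k, ‖chebCoeff h k‖ ≤ B * q ^ k) {t : ℝ} (ht : 1 < t) (hqt : q * t < 1) :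
    AnalyticInside h t := by
  have hq : q < 1 := by nlinarith
  have hsum : Summable fun k => B * (q * t) ^ k :=
    (summable_geometric_of_lt_one (by positivity) hqt).mul_left B
  refine ⟨fun z => ∑' k : ℕ, chebCoeff h k * (Polynomial.Chebyshev.T ℂ (k : ℤ)).eval z,
    DifferentiableOn.analyticOnNhd ?_ (isOpen_inside ht), fun y hy => ?_⟩
  · refine Complex.differentiableOn_tsum_of_summable_norm hsum (fun k => by fun_prop)
      (isOpen_inside ht) fun k z hz => ?_
    rw [norm_mul, mul_pow, ← mul_assoc]
    refine mul_le_mul (hB k) ((norm_eval_T_le k z).trans ?_) (norm_nonneg _)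
      ((norm_nonneg _).trans (hB k))
    exact pow_le_pow_left₀ (zero_le_one.trans (one_le_level z)) (le_of_lt hz) k
  · have := hasSum_chebyshev hh (summable_cosCoeff hq0 hq hB) hy
    simp only [Polynomial.Chebyshev.complex_ofReal_eval_T] at this
    exact this.tsum_eq

end Series

/-! ### Bernstein's theorem -/

lemma supDist_le_ofReal {u v : ℝ → ℂ} {ε : ℝ} (h : ∀ x ∈ Icc (-1 : ℝ) 1, ‖u x - v x‖ ≤ ε) :
    supDist u v ≤ ENNReal.ofReal ε :=
  iSup₂_le fun x hx => by
    rw [← ofReal_norm]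
    exact ENNReal.ofReal_le_ofReal (h x hx)

lemma norm_sub_le_of_supDist_le {u v : ℝ → ℂ} {ε : ℝ} (hε : 0 ≤ ε)
    (h : supDist u v ≤ ENNReal.ofReal ε) {x : ℝ} (hx : x ∈ Icc (-1 : ℝ) 1) :
    ‖u x - v x‖ ≤ ε := by
  have := (le_iSup₂ (f := fun x (_ : x ∈ Icc (-1 : ℝ) 1) => ‖u x - v x‖ₑ) x hx).trans h
  rwa [← ofReal_norm, ENNReal.ofReal_le_ofReal_iff hε] at this

lemma geomBound_of_supDist {h : ℝ → ℂ} {v : ℕ → ℝ → ℂ} {C r : ℝ} (hr : 0 ≤ r)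
    (hv : ∀ n, ∀ y ∈ Icc (-1 : ℝ) 1, ‖h y - v n y‖ ≤ C * r ^ n) :
    GeomBound (fun n => supDist h (v n)) r := by
  have hC : 0 ≤ C := by
    simpa using (norm_nonneg _).trans (hv 0 0 (by norm_num))
  refine ⟨⟨C, hC⟩, fun n => (supDist_le_ofReal (hv n)).trans_eq ?_⟩
  rw [ENNReal.ofReal_mul hC, ENNReal.ofReal_pow hr, ENNReal.ofReal_eq_coe_nnreal hC]
  rfl

/-- If `h` extends to a bounded analytic function inside `B_ρ`, its Chebyshev projections and
interpolants converge like `ρ ^ (-n)`. -/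
lemma geomBound_of_bounded {h : ℝ → ℂ} {F : ℂ → ℂ} {ρ M : ℝ} (hρ : 1 < ρ)
    (hF : AnalyticOnNhd ℂ F (inside ρ)) (hM : ∀ z ∈ inside ρ, ‖F z‖ ≤ M)
    (hFh : ∀ y ∈ Icc (-1 : ℝ) 1, F y = h y) (hh : ContinuousOn h (Icc (-1) 1)) :
    GeomBound (fun n => supDist h (chebProj h n)) ρ⁻¹ ∧
      GeomBound (fun n => supDist h (chebInterp h n)) ρ⁻¹ := by
  have hq0 : 0 ≤ ρ⁻¹ := inv_nonneg.mpr (by linarith)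
  have hq : ρ⁻¹ < 1 := inv_lt_one_of_one_lt₀ hρ
  have hB (k : ℕ) : ‖chebCoeff h k‖ ≤ 2 * M * ρ⁻¹ ^ k := by
    rw [mul_assoc]
    exact (norm_chebCoeff_le_two_mul h k).trans
      (mul_le_mul_of_nonneg_left (norm_cosCoeff_le hρ hF hM hFh hh k) two_pos.le)
  constructor
  · refine geomBound_of_supDist (C := 2 * M * ρ⁻¹ / (1 - ρ⁻¹)) hq0 fun n y hy => ?_
    refine (norm_sub_chebProj_le hh hq0 hq hB n hy).trans_eq ?_
    ring
  · refine geomBound_of_supDist (C := 2 * (2 * M) * ρ⁻¹ / (1 - ρ⁻¹)) hq0 fun n y hy => ?_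
    refine (norm_sub_chebInterp_le hh hq0 hq hB n hy).trans_eq ?_
    ring

lemma GeomBound.mono {e : ℕ → ℝ≥0∞} {r s : ℝ} (he : GeomBound e r) (hrs : r ≤ s) :
    GeomBound e s := by
  obtain ⟨c, hc⟩ := he
  refine ⟨c, fun n => (hc n).trans ?_⟩
  gcongr

lemma GeomBound.of_le {e e' : ℕ → ℝ≥0∞} {r : ℝ} (he : GeomBound e r) (hle : ∀ n, e' n ≤ e n) :
    GeomBound e' r := by
  obtain ⟨c, hc⟩ := he
  exact ⟨c, fun n => (hle n).trans (hc n)⟩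

/-- The direct half of Bernstein's theorem, for functions analytic inside `B_ρ` that need not be
bounded there: each rate `r > 1 / ρ` comes from a slightly smaller ellipse. -/
lemma geomBound_of_analytic {h : ℝ → ℂ} {F : ℂ → ℂ} {ρ r : ℝ} (hρ : 1 < ρ)
    (hF : AnalyticOnNhd ℂ F (inside ρ)) (hFh : ∀ y ∈ Icc (-1 : ℝ) 1, F y = h y)
    (hh : ContinuousOn h (Icc (-1) 1)) (hr : ρ⁻¹ < r) :
    GeomBound (fun n => supDist h (chebProj h n)) r ∧
      GeomBound (fun n => supDist h (chebInterp h n)) r := by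
  have hr0 : 0 < r := lt_trans (inv_pos.mpr (by linarith)) hr
  obtain ⟨s, hs, hsρ⟩ := exists_between (max_lt hρ (inv_lt_of_inv_lt₀ (by linarith) hr))
  have hs1 : 1 < s := (le_max_left _ _).trans_lt hs
  have hsr : s⁻¹ ≤ r := inv_le_of_inv_le₀ hr0 ((le_max_right _ _).trans hs.le)
  obtain ⟨M, hM⟩ := exists_bound_inside hs1 hsρ hF
  obtain ⟨h1, h2⟩ := geomBound_of_bounded hs1 (hF.mono (inside_mono hsρ.le)) hM hFh hh
  exact ⟨h1.mono hsr, h2.mono hsr⟩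

/-- A bound that holds for all large `k` holds for all `k` after enlarging the constant. -/
lemma exists_forall_le_mul_pow {a : ℕ → ℝ} (ha : ∀ k, 0 ≤ a k) {B q : ℝ} (hq : 0 < q)
    (hev : ∀ᶠ k in atTop, a k ≤ B * q ^ k) : ∃ C, ∀ k, a k ≤ C * q ^ k := by
  obtain ⟨N, hN⟩ := eventually_atTop.mp hev
  have hs : ∀ k, 0 ≤ a k / q ^ k := fun k => div_nonneg (ha k) (by positivity)
  refine ⟨|B| + ∑ k ∈ Finset.range N, a k / q ^ k, fun k => ?_⟩
  rw [← div_le_iff₀ (by positivity)]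
  rcases lt_or_ge k N with hk | hk
  · exact (Finset.single_le_sum (fun i _ => hs i) (Finset.mem_range.mpr hk)).trans
      (le_add_of_nonneg_left (abs_nonneg B))
  · exact (((div_le_iff₀ (by positivity)).mpr (hN k hk)).trans (le_abs_self B)).trans
      (le_add_of_nonneg_right (Finset.sum_nonneg fun i _ => hs i))

/-- The converse half of Bernstein's theorem: if the errors of best polynomial approximation decay
faster than `ρ ^ (-n)`, then `h` extends analytically to an ellipse larger than the inside of
`B_ρ`. -/
lemma exists_analyticInside_of_limsup_lt {h : ℝ → ℂ} {ρ : ℝ} (hρ : 1 < ρ)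
    (hh : ContinuousOn h (Icc (-1) 1))
    (hlim : limsup (fun n : ℕ => polyBestError h n ^ (1 / (n : ℝ))) atTop <
      ENNReal.ofReal ρ⁻¹) :
    ∃ t, ρ < t ∧ AnalyticInside h t := by
  obtain ⟨q', hq1, hq2⟩ := ENNReal.lt_iff_exists_nnreal_btwn.mp hlim
  obtain ⟨q, hq⟩ : ∃ q : ℝ, q = q' := ⟨_, rfl⟩
  have hq0 : 0 < q := by
    have : (0 : ℝ≥0∞) < q' := bot_le.trans_lt hq1
    rw [hq]
    exact_mod_cast this
  have hqρ : q < ρ⁻¹ := by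
    rw [← ENNReal.ofReal_coe_nnreal, ← hq] at hq2
    exact (ENNReal.ofReal_lt_ofReal_iff (inv_pos.mpr (by linarith))).mp hq2
  -- the coefficient of index `n + 1` is bounded by twice the error of degree `n`
  have hev : ∀ᶠ k : ℕ in atTop, ‖chebCoeff h k‖ ≤ 2 * q⁻¹ * q ^ k := by
    refine (tendsto_sub_atTop_nat 1).eventually
      (p := fun n => 0 < n → ‖chebCoeff h (n + 1)‖ ≤ 2 * q⁻¹ * q ^ (n + 1)) ?_ |>.and
        (eventually_ge_atTop 2) |>.mono ?_
    · filter_upwards [eventually_lt_of_limsup_lt hq1] with n hn hn0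
      have hn0' : (0 : ℝ) < n := by exact_mod_cast hn0
      have hlt : polyBestError h n < ENNReal.ofReal (q ^ n) := by
        have := ENNReal.rpow_lt_rpow hn hn0'
        rw [← ENNReal.rpow_mul, one_div_mul_cancel hn0'.ne', ENNReal.rpow_one,
          ENNReal.rpow_natCast] at this
        rwa [ENNReal.ofReal_pow hq0.le, hq, ENNReal.ofReal_coe_nnreal]
      simp only [polyBestError, iInf_lt_iff] at hlt
      obtain ⟨P, hP, hPd⟩ := hlt
      have := norm_chebCoeff_le_of_degree_le hh hP (Nat.lt_succ_self n)
        fun y hy => norm_sub_le_of_supDist_le (by positivity) hPd.le hy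
      refine this.trans_eq ?_
      rw [pow_succ]
      field_simp
    · rintro k ⟨hk, hk2⟩
      have := hk (by omega)
      rwa [Nat.sub_add_cancel (by omega)] at this
  obtain ⟨C, hC⟩ := exists_forall_le_mul_pow (fun k => norm_nonneg _) hq0 hev
  obtain ⟨t, ht, htq⟩ := exists_between ((lt_inv_comm₀ hq0 (by linarith)).mp hqρ)
  refine ⟨t, ht, analyticInside_of_norm_chebCoeff_le hh hq0.le hC (hρ.trans ht) ?_⟩
  rwa [mul_comm, ← lt_div_iff₀ hq0, one_div]

/-- Geometric bounds with every `r > r₀` bound the rate of convergence by `r₀`. -/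
lemma limsup_rpow_le_of_geomBound {e : ℕ → ℝ≥0∞} {r₀ : ℝ} (h0 : 0 ≤ r₀)
    (he : ∀ r, r₀ < r → GeomBound e r) :
    limsup (fun n : ℕ => e n ^ (1 / (n : ℝ))) atTop ≤ ENNReal.ofReal r₀ := by
  refine le_of_forall_gt fun b hb => ?_
  obtain ⟨s', hs1, hs2⟩ := ENNReal.lt_iff_exists_nnreal_btwn.mp hb
  rw [← ENNReal.ofReal_coe_nnreal] at hs1
  have hs : r₀ < s' := ((ENNReal.ofReal_lt_ofReal_iff_of_nonneg h0).mp hs1)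
  have hs0 : (0 : ℝ) < s' := h0.trans_lt hs
  obtain ⟨r, hr1, hr2⟩ := exists_between hs
  have hr0 : 0 ≤ r := h0.trans hr1.le
  obtain ⟨c, hc⟩ := he r hr1
  refine lt_of_le_of_lt (limsup_le_of_le (by isBoundedDefault) ?_) hs2
  have htend : Tendsto (fun n : ℕ => (c : ℝ) * (r / s') ^ n) atTop (𝓝 0) := by
    simpa using (tendsto_pow_atTop_nhds_zero_of_lt_one (div_nonneg hr0 hs0.le)
      ((div_lt_one hs0).mpr hr2)).const_mul (c : ℝ)
  filter_upwards [htend.eventually_le_const one_pos, eventually_gt_atTop 0] with n hn hn0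
  have hn0' : (0 : ℝ) < n := by exact_mod_cast hn0
  have hle : e n ≤ (s' : ℝ≥0∞) ^ n := by
    refine (hc n).trans ?_
    rw [← ENNReal.ofReal_coe_nnreal (p := c), ← ENNReal.ofReal_coe_nnreal (p := s'),
      ← ENNReal.ofReal_pow hr0, ← ENNReal.ofReal_mul c.coe_nonneg, ← ENNReal.ofReal_pow hs0.le]
    refine ENNReal.ofReal_le_ofReal ?_
    rwa [div_pow, ← mul_div_assoc, div_le_one (by positivity)] at hn
  calc e n ^ (1 / (n : ℝ)) ≤ ((s' : ℝ≥0∞) ^ n) ^ (1 / (n : ℝ)) :=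
        ENNReal.rpow_le_rpow hle (by positivity)
    _ = s' := by
        rw [← ENNReal.rpow_natCast, ← ENNReal.rpow_mul, mul_one_div_cancel hn0'.ne',
          ENNReal.rpow_one]

/-! ### Transplantation by `y = sin (p x) / sin p` -/

section Transplant

variable {p : ℝ}

lemma sin_pos_of_lt_pi_div_two (hp0 : 0 < p) (hp : p < Real.pi / 2) : 0 < Real.sin p :=
  Real.sin_pos_of_pos_of_lt_pi hp0 (by linarith)

lemma mul_mem_Icc_pi_div_two (hp0 : 0 < p) (hp : p < Real.pi / 2) {x : ℝ}
    (hx : x ∈ Icc (-1 : ℝ) 1) : p * x ∈ Icc (-(Real.pi / 2)) (Real.pi / 2) :=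
  ⟨by nlinarith [hx.1], by nlinarith [hx.2]⟩

lemma sin_div_sin_mem_Icc (hp0 : 0 < p) (hp : p < Real.pi / 2) {x : ℝ}
    (hx : x ∈ Icc (-1 : ℝ) 1) : Real.sin (p * x) / Real.sin p ∈ Icc (-1 : ℝ) 1 := by
  have hs := sin_pos_of_lt_pi_div_two hp0 hp
  have hpx := mul_mem_Icc_pi_div_two hp0 hp hx
  rw [mem_Icc, le_div_iff₀ hs, div_le_iff₀ hs, neg_one_mul, one_mul, ← Real.sin_neg]
  exact ⟨Real.sin_le_sin_of_le_of_le_pi_div_two (by linarith) hpx.2 (by nlinarith [hx.1]),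
    Real.sin_le_sin_of_le_of_le_pi_div_two hpx.1 hp.le (by nlinarith [hx.2])⟩

lemma g_sin_div_sin (hp0 : 0 < p) (hp : p < Real.pi / 2) {x : ℝ} (hx : x ∈ Icc (-1 : ℝ) 1) :
    g p (Real.sin (p * x) / Real.sin p) = x := by
  have hpx := mul_mem_Icc_pi_div_two hp0 hp hx
  rw [g, div_mul_cancel₀ _ (sin_pos_of_lt_pi_div_two hp0 hp).ne', Real.arcsin_sin hpx.1 hpx.2]
  field_simp

lemma sin_mul_g_div_sin (hp0 : 0 < p) (hp : p < Real.pi / 2) {y : ℝ} (hy : y ∈ Icc (-1 : ℝ) 1) :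
    Real.sin (p * g p y) / Real.sin p = y := by
  have hs := sin_pos_of_lt_pi_div_two hp0 hp
  have hs1 := Real.sin_le_one p
  rw [g, ← mul_assoc, mul_one_div_cancel hp0.ne', one_mul,
    Real.sin_arcsin (by nlinarith [hy.1]) (by nlinarith [hy.2]), mul_div_cancel_right₀ _ hs.ne']

lemma g_mem_Icc (hp0 : 0 < p) (hp : p < Real.pi / 2) {y : ℝ} (hy : y ∈ Icc (-1 : ℝ) 1) :
    g p y ∈ Icc (-1 : ℝ) 1 := by
  have hs := sin_pos_of_lt_pi_div_two hp0 hp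
  have h1 : Real.arcsin (y * Real.sin p) ≤ p := by
    rw [← Real.arcsin_sin (by linarith : -(Real.pi / 2) ≤ p) hp.le,
      Real.sin_arcsin (Real.neg_one_le_sin p) (Real.sin_le_one p)]
    exact Real.monotone_arcsin (by nlinarith [hy.2])
  have h2 : -p ≤ Real.arcsin (y * Real.sin p) := by
    conv_lhs => rw [← Real.arcsin_sin (by linarith : -(Real.pi / 2) ≤ p) hp.le]
    rw [← Real.arcsin_neg]
    exact Real.monotone_arcsin (by nlinarith [hy.1])
  rw [g, one_div, inv_mul_eq_div, mem_Icc, le_div_iff₀ hp0, div_le_iff₀ hp0]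
  constructor <;> linarith

lemma supDist_comp_sin (hp0 : 0 < p) (hp : p < Real.pi / 2) (f v : ℝ → ℂ) :
    supDist f (fun x => v (Real.sin (p * x) / Real.sin p)) = supDist (ftilde p f) v := by
  refine le_antisymm (iSup₂_le fun x hx => ?_) (iSup₂_le fun y hy => ?_)
  · refine le_trans (le_of_eq ?_) (le_iSup₂
      (f := fun y (_ : y ∈ Icc (-1 : ℝ) 1) => ‖ftilde p f y - v y‖ₑ) _
      (sin_div_sin_mem_Icc hp0 hp hx))
    simp only [ftilde, g_sin_div_sin hp0 hp hx]
  · refine le_trans (le_of_eq ?_) (le_iSup₂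
      (f := fun x (_ : x ∈ Icc (-1 : ℝ) 1) => ‖f x - v (Real.sin (p * x) / Real.sin p)‖ₑ) _
      (g_mem_Icc hp0 hp hy))
    simp only [ftilde, sin_mul_g_div_sin hp0 hp hy]

lemma supDist_congr_right {u v w : ℝ → ℂ} (h : ∀ x ∈ Icc (-1 : ℝ) 1, v x = w x) :
    supDist u v = supDist u w :=
  biSup_congr fun x hx => by rw [h x hx]

open Polynomial in
/-- `S_n` is the image of the polynomials of degree at most `n` under `y = sin (p x) / sin p`. -/
lemma mem_S_iff {n : ℕ} {u : ℝ → ℂ} : u ∈ S p n ↔ ∃ P ∈ degreeLE ℂ n,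
    u = fun x => P.eval ((Real.sin (p * x) / Real.sin p : ℝ) : ℂ) := by
  let Φ : ℂ[X] →ₗ[ℂ] (ℝ → ℂ) := LinearMap.pi fun x =>
    leval ((Real.sin (p * x) / Real.sin p : ℝ) : ℂ)
  have hS : S p n = (degreeLE ℂ n).map Φ := by
    rw [← span_chebyshev_eq_degreeLE, Submodule.map_span, S]
    congr 1
    ext v
    simp only [mem_ofPred_eq, mem_image, mem_Iic, exists_exists_and_eq_and]
    refine exists_congr fun k => and_congr_right fun _ => ?_
    rw [eq_comm]
    refine iff_of_eq (congrArg (· = v) (funext fun x => ?_))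
    exact Chebyshev.complex_ofReal_eval_T _ _
  rw [hS, Submodule.mem_map]
  exact exists_congr fun P => and_congr_right fun _ => eq_comm

open Polynomial in
/-- The interpolant in `S_n` exists and is unique, namely the transplanted interpolating polynomial.
The equality holds on all of `ℝ` because both sides are polynomials in `sin (p x) / sin p`. -/
lemma isInterpolant_iff (hp0 : 0 < p) (hp : p < Real.pi / 2) {f : ℝ → ℂ} {n : ℕ} {u : ℝ → ℂ} :
    IsInterpolant p f n u ↔
      u = fun x : ℝ => chebInterp (ftilde p f) n (Real.sin (p * x) / Real.sin p) := by
  constructor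
  · rintro ⟨hu, hi⟩
    obtain ⟨P, hP, rfl⟩ := mem_S_iff.mp hu
    funext x
    refine eq_chebInterp hP (fun i hin => ?_) _
    have := hi i hin
    simp only [sin_mul_g_div_sin hp0 hp (node_mem_Icc n i)] at this
    exact this
  · rintro rfl
    refine ⟨mem_S_iff.mpr ⟨_, ?_, rfl⟩, fun i hin => ?_⟩
    · rw [mem_degreeLE]
      have := Lagrange.degree_interpolate_lt (fun i => ftilde p f (node n i)) (injOn_node n)
      rw [Finset.card_range] at this
      exact Order.lt_succ_iff.mp (by exact_mod_cast this)
    · simp only [sin_mul_g_div_sin hp0 hp (node_mem_Icc n i)]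
      exact Lagrange.eval_interpolate_at_node (fun i => ftilde p f (node n i)) (injOn_node n)
        (Finset.mem_range.mpr (Nat.lt_succ_of_le hin))

lemma bestError_eq_polyBestError (hp0 : 0 < p) (hp : p < Real.pi / 2) (f : ℝ → ℂ) (n : ℕ) :
    bestError p f n = polyBestError (ftilde p f) n := by
  refine le_antisymm (le_iInf₂ fun P hP => ?_) (le_iInf₂ fun u hu => ?_)
  · rw [← supDist_comp_sin hp0 hp f fun y => P.eval (y : ℂ)]
    exact iInf₂_le _ (mem_S_iff.mpr ⟨P, hP, rfl⟩)
  · obtain ⟨P, hP, rfl⟩ := mem_S_iff.mp hu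
    rw [supDist_comp_sin hp0 hp f fun y => P.eval (y : ℂ)]
    exact iInf₂_le _ hP

lemma chebCoeff_congr {h₁ h₂ : ℝ → ℂ} (h : ∀ y ∈ Icc (-1 : ℝ) 1, h₁ y = h₂ y) (k : ℕ) :
    chebCoeff h₁ k = chebCoeff h₂ k := by
  rw [chebCoeff, chebCoeff]
  congr 1
  refine intervalIntegral.integral_congr fun y hy => ?_
  rw [uIcc_of_le (by norm_num)] at hy
  simp only [h y hy]

/-- The normalization: the Chebyshev coefficient of `T_k` of index `k` is `1`. -/
lemma chebCoeff_T (k : ℕ) :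
    chebCoeff (fun y => (((Polynomial.Chebyshev.T ℝ (k : ℤ)).eval y : ℝ) : ℂ)) k = 1 := by
  have hpi : (Real.pi : ℂ) ≠ 0 := Complex.ofReal_ne_zero.mpr Real.pi_ne_zero
  have h0 : ∫ θ in (0 : ℝ)..Real.pi, (Polynomial.Chebyshev.T ℝ (k : ℤ)).eval (Real.cos θ) *
      (Polynomial.Chebyshev.T ℝ (k : ℤ)).eval (Real.cos θ) =
      Real.pi / (2 / (if k = 0 then 2 else 1)) := by
    rw [← Polynomial.Chebyshev.integral_measureT_eq_integral_cos (f := fun y =>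
      (Polynomial.Chebyshev.T ℝ (k : ℤ)).eval y * (Polynomial.Chebyshev.T ℝ (k : ℤ)).eval y)]
    rcases eq_or_ne k 0 with rfl | hk
    · rw [Nat.cast_zero, Polynomial.Chebyshev.integral_eval_T_real_mul_self_measureT_zero]
      simp
    · rw [Polynomial.Chebyshev.integral_T_real_mul_self_measureT_of_ne_zero hk, if_neg hk]
      simp
  have h1 := congrArg Complex.ofReal h0
  rw [← intervalIntegral.integral_ofReal] at h1
  rw [chebCoeff_eq_cosCoeff, cosCoeff]
  simp only [Polynomial.Chebyshev.T_real_cos, Complex.ofReal_mul] at h1 ⊢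
  rw [h1]
  split_ifs <;> push_cast <;> field_simp

/-- The substitution `y = sin (p x) / sin p` carries the weight `w̄` to a multiple of the Chebyshev
weight `1 / √(1 - y²)`. -/
lemma innerW_psi (hp0 : 0 < p) (hp : p < Real.pi / 2) (u : ℝ → ℂ) (k : ℕ) :
    innerW p u (psi p k) = (Real.sin p / p : ℝ) *
      (((if k = 0 then 2 else 1) * (Real.pi : ℂ)) / 2 * chebCoeff (ftilde p u) k) := by
  have hs := sin_pos_of_lt_pi_div_two hp0 hp
  have hpi : (Real.pi : ℂ) ≠ 0 := Complex.ofReal_ne_zero.mpr Real.pi_ne_zero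
  have key := intervalIntegral.integral_deriv_smul_comp_of_deriv_nonneg (a := -1) (b := 1)
    (f := fun x => Real.sin (p * x) / Real.sin p)
    (f' := fun x => p * Real.cos (p * x) / Real.sin p)
    (g := fun y => ftilde p u y *
      (((Polynomial.Chebyshev.T ℝ (k : ℤ)).eval y / √(1 - y ^ 2) : ℝ) : ℂ))
    (by fun_prop)
    (fun x _ => by
      have := ((hasDerivAt_id x).const_mul p).sin.div_const (Real.sin p)
      simpa [mul_comm] using this)
    (fun x hx => by
      have hx' : x ∈ Icc (-1 : ℝ) 1 := by
        simp only [mem_Ioo] at hx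
        norm_num at hx
        exact ⟨hx.1.le, hx.2.le⟩
      have := Real.cos_nonneg_of_mem_Icc (mul_mem_Icc_pi_div_two hp0 hp hx')
      positivity)
  have e1 : Real.sin (p * 1) / Real.sin p = 1 := by rw [mul_one, div_self hs.ne']
  have e2 : Real.sin (p * -1) / Real.sin p = -1 := by
    rw [mul_neg_one, Real.sin_neg, neg_div, div_self hs.ne']
  rw [e1, e2] at key
  have e3 : ((if k = 0 then 2 else 1) * (Real.pi : ℂ)) / 2 * chebCoeff (ftilde p u) k =
      ∫ y in (-1 : ℝ)..1, ftilde p u y *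
        (((Polynomial.Chebyshev.T ℝ (k : ℤ)).eval y / √(1 - y ^ 2) : ℝ) : ℂ) := by
    rw [chebCoeff, ← mul_assoc]
    have hβ : (if k = 0 then 2 else 1 : ℂ) ≠ 0 := by split_ifs <;> norm_num
    rw [div_mul_div_cancel₀ two_ne_zero, div_self (mul_ne_zero hβ hpi), one_mul]
  rw [e3, ← key, ← intervalIntegral.integral_const_mul, innerW]
  refine intervalIntegral.integral_congr fun x hx => ?_
  rw [uIcc_of_le (by norm_num)] at hx
  have hpc : (p : ℂ) ≠ 0 := Complex.ofReal_ne_zero.mpr hp0.ne'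
  have hsc : ((Real.sin p : ℝ) : ℂ) ≠ 0 := Complex.ofReal_ne_zero.mpr hs.ne'
  simp only [Function.comp_apply, ftilde, g_sin_div_sin hp0 hp hx, psi, weight, Complex.real_smul,
    div_pow]
  push_cast at hsc ⊢
  field_simp

lemma proj_eq_chebProj (hp0 : 0 < p) (hp : p < Real.pi / 2) (f : ℝ → ℂ) (n : ℕ) (x : ℝ) :
    proj p f n x = chebProj (ftilde p f) n (Real.sin (p * x) / Real.sin p) := by
  refine Finset.sum_congr rfl fun k _ => ?_
  have h1 : chebCoeff (ftilde p (psi p k)) k = 1 := by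
    rw [← chebCoeff_T k]
    refine chebCoeff_congr (fun y hy => ?_) k
    rw [ftilde, psi, sin_mul_g_div_sin hp0 hp hy]
  have hs : ((Real.sin p / p : ℝ) : ℂ) ≠ 0 :=
    Complex.ofReal_ne_zero.mpr (div_pos (sin_pos_of_lt_pi_div_two hp0 hp) hp0).ne'
  have hβ : ((if k = 0 then 2 else 1) * (Real.pi : ℂ)) / 2 ≠ 0 := by
    have hpi : (Real.pi : ℂ) ≠ 0 := Complex.ofReal_ne_zero.mpr Real.pi_ne_zero
    refine div_ne_zero (mul_ne_zero ?_ hpi) two_ne_zero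
    split_ifs <;> norm_num
  rw [innerW_psi hp0 hp, innerW_psi hp0 hp, h1, mul_one, mul_div_mul_left _ _ hs,
    mul_div_cancel_left₀ _ hβ]
  rfl

lemma proj_mem_S (f : ℝ → ℂ) (n : ℕ) : proj p f n ∈ S p n := by
  have : proj p f n = ∑ k ∈ Finset.range (n + 1),
      (innerW p f (psi p k) / innerW p (psi p k) (psi p k)) • psi p k := by
    funext x
    simp [proj, Finset.sum_apply]
  rw [this]
  exact Submodule.sum_mem _ fun k hk => Submodule.smul_mem _ _
    (Submodule.subset_span ⟨k, Nat.lt_succ_iff.mp (Finset.mem_range.mp hk), rfl⟩)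

/-! ### The level curve through `± 1 / sin p` -/

lemma cot_half_eq_inv_tan_half : Real.cot (p / 2) = (Real.tan (p / 2))⁻¹ := by
  rw [Real.tan_eq_sin_div_cos, Real.cot_eq_cos_div_sin, inv_div]

lemma tan_half_pos (hp0 : 0 < p) (hp : p < Real.pi / 2) : 0 < Real.tan (p / 2) :=
  Real.tan_pos_of_pos_of_lt_pi_div_two (by linarith) (by linarith)

lemma one_lt_cot_half (hp0 : 0 < p) (hp : p < Real.pi / 2) : 1 < Real.cot (p / 2) := by
  rw [cot_half_eq_inv_tan_half]
  refine (one_lt_inv₀ (tan_half_pos hp0 hp)).mpr ?_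
  rw [← Real.tan_pi_div_four]
  exact Real.tan_lt_tan_of_lt_of_lt_pi_div_two (by linarith) (by linarith) (by linarith)

lemma one_add_cos_div_sin (hp0 : 0 < p) (hp : p < Real.pi / 2) :
    (1 + Real.cos p) / Real.sin p = Real.cot (p / 2) := by
  have hs : 0 < Real.sin (p / 2) := Real.sin_pos_of_pos_of_lt_pi (by linarith) (by linarith)
  have hc : 0 < Real.cos (p / 2) := Real.cos_pos_of_mem_Ioo ⟨by linarith, by linarith⟩
  have e : p = 2 * (p / 2) := by ring
  rw [Real.cot_eq_cos_div_sin]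
  conv_lhs => rw [e]
  rw [Real.sin_two_mul, Real.cos_two_mul]
  field_simp
  ring

lemma sqrt_one_div_sin_sq_sub_one (hp0 : 0 < p) (hp : p < Real.pi / 2) :
    √(1 / Real.sin p ^ 2 - 1) = Real.cos p / Real.sin p := by
  have hs := sin_pos_of_lt_pi_div_two hp0 hp
  have hc : 0 < Real.cos p := Real.cos_pos_of_mem_Ioo ⟨by linarith, hp⟩
  have e : 1 / Real.sin p ^ 2 - 1 = (Real.cos p / Real.sin p) ^ 2 := by
    rw [div_pow, Real.cos_sq']
    field_simp
  rw [e, Real.sqrt_sq (by positivity)]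

lemma level_one_div_sin (hp0 : 0 < p) (hp : p < Real.pi / 2) :
    level (1 / Real.sin p : ℝ) = Real.cot (p / 2) := by
  have h1 := one_lt_cot_half hp0 hp
  have hs : 0 < Real.sin (p / 2) := Real.sin_pos_of_pos_of_lt_pi (by linarith) (by linarith)
  have hc : 0 < Real.cos (p / 2) := Real.cos_pos_of_mem_Ioo ⟨by linarith, by linarith⟩
  -- `1 / sin p = (cot (p / 2) + tan (p / 2)) / 2`
  have e : ((1 / Real.sin p : ℝ) : ℂ) = joukowski (Real.cot (p / 2) : ℝ) := by
    rw [joukowski]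
    norm_cast
    have e : p = 2 * (p / 2) := by ring
    conv_lhs => rw [e]
    rw [Real.sin_two_mul, Real.cot_eq_cos_div_sin, inv_div]
    field_simp
    linarith [Real.sin_sq_add_cos_sq (p / 2)]
  have hn : ‖((Real.cot (p / 2) : ℝ) : ℂ)‖ = Real.cot (p / 2) := by
    rw [Complex.norm_real, Real.norm_of_nonneg (by linarith)]
  rw [e, level_joukowski_of_one_le (by rw [hn]; exact h1.le), hn]

end Transplant

/-- If `F` has no analytic continuation to a point `s` of `B_ρ`, then no function on `[-1, 1]` that
`F` continues is analytic inside a larger level curve: by the identity theorem such an extension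
would continue `F` to `s`. -/
lemma le_level_of_singularAt {h : ℝ → ℂ} {F : ℂ → ℂ} {s : ℂ} {t : ℝ} (hs : 1 < level s)
    (hF : AnalyticOnNhd ℂ F (inside (level s))) (hFh : ∀ y ∈ Icc (-1 : ℝ) 1, F y = h y)
    (hsing : SingularAt F (inside (level s)) s) (hG : AnalyticInside h t) : t ≤ level s := by
  by_contra! hlt
  obtain ⟨G, hGa, hGh⟩ := hG
  refine hsing ⟨G, hGa s hlt, ?_⟩
  have heq := eqOn_inside hs (hGa.mono (inside_mono hlt.le)) hF
    fun y hy => (hGh y hy).trans (hFh y hy).symm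
  filter_upwards [self_mem_nhdsWithin] with z hz
  exact heq hz

lemma continuousOn_of_analytic {h : ℝ → ℂ} {F : ℂ → ℂ} {ρ : ℝ} (hρ : 1 < ρ)
    (hF : AnalyticOnNhd ℂ F (inside ρ)) (hFh : ∀ y ∈ Icc (-1 : ℝ) 1, F y = h y) :
    ContinuousOn h (Icc (-1) 1) := by
  have : ContinuousOn (fun y : ℝ => F y) (Icc (-1) 1) :=
    hF.continuousOn.comp Complex.continuous_ofReal.continuousOn
      fun y hy => ofReal_mem_inside hρ hy
  exact this.congr fun y hy => (hFh y hy).symm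

end Nptp

/-! ### Convergence of the transplanted approximations -/

theorem mainTheorem3 (p : ℝ) (hp0 : 0 < p) (hp : p < Real.pi / 2) (f : ℝ → ℂ) (F : ℂ → ℂ)
    -- `F` continues `f̃` analytically, and its nearest singularities are at `± 1 / sin p`
    (hFf : ∀ y ∈ Icc (-1 : ℝ) 1, F y = Nptp.ftilde p f y)
    (hF : AnalyticOnNhd ℂ F (Nptp.inside (Nptp.level (1 / Real.sin p : ℝ))))
    (hsing :
      Nptp.SingularAt F (Nptp.inside (Nptp.level (1 / Real.sin p : ℝ))) (1 / Real.sin p : ℝ) ∨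
      Nptp.SingularAt F (Nptp.inside (Nptp.level (1 / Real.sin p : ℝ))) (-(1 / Real.sin p) : ℝ)) :
    -- the largest `t` such that `f̃` is analytic inside `B_t`
    (1 / Real.sin p + √(1 / Real.sin p ^ 2 - 1) = (1 + Real.cos p) / Real.sin p ∧
      (1 + Real.cos p) / Real.sin p = Real.cot (p / 2) ∧
      1 / Real.cot (p / 2) = Real.tan (p / 2) ∧
      IsGreatest {t : ℝ | 1 < t ∧ Nptp.AnalyticInside (Nptp.ftilde p f) t}
        (Real.cot (p / 2))) ∧
    -- approximating `f` in `S_n` is equivalent to approximating `f̃` by polynomials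
    (∀ n, ∀ x ∈ Icc (-1 : ℝ) 1, Nptp.proj p f n x =
      Nptp.chebProj (Nptp.ftilde p f) n (Real.sin (p * x) / Real.sin p)) ∧
    (∀ n u, Nptp.IsInterpolant p f n u ↔ u = fun x : ℝ =>
      Nptp.chebInterp (Nptp.ftilde p f) n (Real.sin (p * x) / Real.sin p)) ∧
    (∀ n, Nptp.supDist f (Nptp.proj p f n) =
      Nptp.supDist (Nptp.ftilde p f) (Nptp.chebProj (Nptp.ftilde p f) n)) ∧
    (∀ n u, Nptp.IsInterpolant p f n u → Nptp.supDist f u =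
      Nptp.supDist (Nptp.ftilde p f) (Nptp.chebInterp (Nptp.ftilde p f) n)) ∧
    (∀ n, Nptp.bestError p f n = Nptp.polyBestError (Nptp.ftilde p f) n) ∧
    -- the asymptotic rate of convergence
    Nptp.HasRate (fun n => Nptp.supDist f (Nptp.proj p f n)) (Real.tan (p / 2)) ∧
    (∀ u : ℕ → ℝ → ℂ, (∀ n, Nptp.IsInterpolant p f n (u n)) →
      Nptp.HasRate (fun n => Nptp.supDist f (u n)) (Real.tan (p / 2))) ∧
    Nptp.HasRate (fun n => Nptp.bestError p f n) (Real.tan (p / 2)) ∧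
    -- the asymptotic accuracy `c r ^ n`, with `r = tan (p / 2)` if `F` is bounded
    (∀ r : ℝ, (Real.tan (p / 2) < r ∨
        r = Real.tan (p / 2) ∧
          ∃ M : ℝ, ∀ z ∈ Nptp.inside (Real.cot (p / 2)), ‖F z‖ ≤ M) →
      Nptp.GeomBound (fun n => Nptp.supDist f (Nptp.proj p f n)) r ∧
      (∀ u : ℕ → ℝ → ℂ, (∀ n, Nptp.IsInterpolant p f n (u n)) →
        Nptp.GeomBound (fun n => Nptp.supDist f (u n)) r) ∧
      Nptp.GeomBound (fun n => Nptp.bestError p f n) r) := by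
  have hρ := Nptp.one_lt_cot_half hp0 hp
  have hτ := Nptp.tan_half_pos hp0 hp
  have hρτ := Nptp.cot_half_eq_inv_tan_half (p := p)
  have hτρ : (Real.cot (p / 2))⁻¹ = Real.tan (p / 2) := by rw [hρτ, inv_inv]
  have hlev := Nptp.level_one_div_sin hp0 hp
  have hlev' : Nptp.level (-(1 / Real.sin p) : ℝ) = Real.cot (p / 2) := by
    rw [Complex.ofReal_neg, Nptp.level_neg, hlev]
  rw [hlev] at hF hsing
  have hh := Nptp.continuousOn_of_analytic hρ hF hFf
  have hmax (t : ℝ) (ht : Nptp.AnalyticInside (Nptp.ftilde p f) t) : t ≤ Real.cot (p / 2) := by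
    rcases hsing with hs | hs
    · rw [← hlev] at hF hs hρ ⊢
      exact Nptp.le_level_of_singularAt hρ hF hFf hs ht
    · rw [← hlev'] at hF hs hρ ⊢
      exact Nptp.le_level_of_singularAt hρ hF hFf hs ht
  have hproj (n : ℕ) : Nptp.supDist f (Nptp.proj p f n) =
      Nptp.supDist (Nptp.ftilde p f) (Nptp.chebProj (Nptp.ftilde p f) n) := by
    rw [← Nptp.supDist_comp_sin hp0 hp f (Nptp.chebProj (Nptp.ftilde p f) n)]
    exact Nptp.supDist_congr_right fun x _ => Nptp.proj_eq_chebProj hp0 hp f n x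
  have hinterp (n : ℕ) (u : ℝ → ℂ) (hu : Nptp.IsInterpolant p f n u) : Nptp.supDist f u =
      Nptp.supDist (Nptp.ftilde p f) (Nptp.chebInterp (Nptp.ftilde p f) n) := by
    rw [(Nptp.isInterpolant_iff hp0 hp).mp hu]
    exact Nptp.supDist_comp_sin hp0 hp f (Nptp.chebInterp (Nptp.ftilde p f) n)
  have hbest_proj (n : ℕ) : Nptp.bestError p f n ≤ Nptp.supDist f (Nptp.proj p f n) :=
    iInf₂_le _ (Nptp.proj_mem_S f n)
  have hgeom (r : ℝ) (hr : Real.tan (p / 2) < r ∨ r = Real.tan (p / 2) ∧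
      ∃ M : ℝ, ∀ z ∈ Nptp.inside (Real.cot (p / 2)), ‖F z‖ ≤ M) :
      Nptp.GeomBound (fun n => Nptp.supDist f (Nptp.proj p f n)) r ∧
      (∀ u : ℕ → ℝ → ℂ, (∀ n, Nptp.IsInterpolant p f n (u n)) →
        Nptp.GeomBound (fun n => Nptp.supDist f (u n)) r) ∧
      Nptp.GeomBound (fun n => Nptp.bestError p f n) r := by
    have key : Nptp.GeomBound (fun n => Nptp.supDist (Nptp.ftilde p f)
          (Nptp.chebProj (Nptp.ftilde p f) n)) r ∧
        Nptp.GeomBound (fun n => Nptp.supDist (Nptp.ftilde p f)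
          (Nptp.chebInterp (Nptp.ftilde p f) n)) r := by
      rcases hr with hr | ⟨rfl, M, hM⟩
      · exact Nptp.geomBound_of_analytic hρ hF hFf hh (hτρ.trans_lt hr)
      · rw [← hτρ]
        exact Nptp.geomBound_of_bounded hρ hF hM hFf hh
    have key1 : Nptp.GeomBound (fun n => Nptp.supDist f (Nptp.proj p f n)) r :=
      key.1.of_le fun n => (hproj n).le
    exact ⟨key1, fun u hu => key.2.of_le fun n => (hinterp n (u n) (hu n)).le,
      key1.of_le hbest_proj⟩
  -- a rate below `tan (p / 2)` would extend `f̃` beyond `B_{cot (p / 2)}`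
  have hlower : ENNReal.ofReal (Real.tan (p / 2)) ≤
      limsup (fun n : ℕ => Nptp.bestError p f n ^ (1 / (n : ℝ))) atTop := by
    by_contra! hlt
    simp only [Nptp.bestError_eq_polyBestError hp0 hp] at hlt
    rw [← hτρ] at hlt
    obtain ⟨t, ht, hta⟩ := Nptp.exists_analyticInside_of_limsup_lt hρ hh hlt
    exact (hmax t hta).not_gt ht
  -- every error lies above the best error, so only the upper bound depends on the method
  have hrate (e : ℕ → ℝ≥0∞) (hle : ∀ n, Nptp.bestError p f n ≤ e n)
      (he : ∀ r, Real.tan (p / 2) < r → Nptp.GeomBound e r) :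
      Nptp.HasRate e (Real.tan (p / 2)) := by
    refine le_antisymm (Nptp.limsup_rpow_le_of_geomBound hτ.le he) (hlower.trans ?_)
    refine limsup_le_limsup (Eventually.of_forall fun n => ?_)
    exact ENNReal.rpow_le_rpow (hle n) (by positivity)
  refine ⟨⟨?_, Nptp.one_add_cos_div_sin hp0 hp, ?_, ⟨hρ, F, hF, hFf⟩, fun t ht => hmax t ht.2⟩,
    fun n x _ => Nptp.proj_eq_chebProj hp0 hp f n x,
    fun n u => Nptp.isInterpolant_iff hp0 hp, hproj, hinterp,
    Nptp.bestError_eq_polyBestError hp0 hp f,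
    hrate _ hbest_proj fun r hr => (hgeom r (Or.inl hr)).1,
    fun u hu => hrate _ (fun n => iInf₂_le _ (hu n).1) fun r hr => (hgeom r (Or.inl hr)).2.1 u hu,
    hrate _ (fun _ => le_rfl) fun r hr => (hgeom r (Or.inl hr)).2.2, hgeom⟩
  · rw [Nptp.sqrt_one_div_sin_sq_sub_one hp0 hp, ← add_div]
  · rw [one_div, hτρ]
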